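/- A topological distance game consists of a finite set $N$ of $n$ agents, utilities $u_i\colon N\to\mathbb{R}$ with $u_i(i)=0$ for every agent $i$, a simple undirected topology graph $G=(V,E)$, and a strictly decreasing distance factor function $f\colon\mathbb{Z}_{\ge 1}\to\mathbb{R}_{>0}$. An assignment is an injective map $\lambda\colon N\to V$, and the utility of agent $i$ in $\lambda$ is $u_i(\lambda)=\sum_{j\ne i} f(d_G(\lambda(i),\lambda(j)))\,u_i(j)$, where $d_G$ is the shortest-path distance in $G$ and the factor is $0$ for nodes in different components. The assignment is jump stable if no agent can strictly increase her utility by moving to an empty node while all other agents stay where they are. The friendship graph is the directed graph on $N$ with an edge from $i$ to $j$ if and only if $u_i(j)>0$; in this case $j$ is called a friend of $i$. Theorem 4.3. Suppose that $G$ is a cycle with $|V|>n$ (and $|V|\ge 3$), and that each agent has at most one friend and utility $0$ for all other agents. For any distance factor function $f$, a jump stable assignment exists if and only if the friendship graph is neither a directed $3$-cycle nor a directed $5$-cycle (on the whole agent set). Moreover, when a jump stable assignment exists, one can be computed in polynomial time: there are a single random access machine program (unit-cost constants, memory access, addition, truncated subtraction and tests) and a single polynomial $p$ such that, for every such game on $n$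 agents and $m=|V|$ nodes that has a jump stable assignment, the program, given $n$, $m$ and the adjacency matrices of $G$ and of the friendship graph, halts within $p(n+m)$ steps and outputs a jump stable assignment of the game. -/

import Mathlib

/-! ### Topological distance games -/

/-- A topological distance game with agent set `N` and node set `V`: the utility `utility i j` that
agent `i` has for agent `j`, the topology graph on `V`, and the strictly decreasing, positive
distance factor function on the integers `k ≥ 1` (its value at `0` is never used). -/
structure TDG (N V : Type*) where
  utility : N → N → ℝ
  utility_self : ∀ i, utility i i = 0
  topology : SimpleGraph V
  factor : ℕ → ℝ
  factor_pos : ∀ k, 1 ≤ k → 0 < factor k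
  factor_strictAnti : StrictAntiOn factor (Set.Ici 1)

namespace TDG

variable {N V : Type*}

/-- The friendship graph: there is an edge from `i` to `j` iff `j` is a friend of `i`, that is,
`i` has positive utility for `j`. -/
def friendshipGraph (T : TDG N V) : Digraph N where
  Adj i j := 0 < T.utility i j

/-- Each agent has at most one friend, and utility `0` for all agents that are not her friend. -/
def AtMostOneFriend (T : TDG N V) : Prop :=
  (∀ i j k, T.friendshipGraph.Adj i j → T.friendshipGraph.Adj i k → j = k) ∧
    ∀ i j, ¬ T.friendshipGraph.Adj i j → T.utility i j = 0

open Classical in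
/-- The distance factor between two distinct nodes: `f (d_G(v, w))` if `v` and `w` are in the same
connected component of the topology graph, and `0` otherwise. -/
noncomputable def nodeFactor (T : TDG N V) (v w : V) : ℝ :=
  if T.topology.Reachable v w then T.factor (T.topology.dist v w) else 0

/-- The utility of agent `i` when the agents are placed according to `a`. -/
noncomputable def agentUtility [Fintype N] [DecidableEq N] (T : TDG N V) (i : N) (a : N → V) : ℝ :=
  ∑ j ∈ Finset.univ.erase i, T.nodeFactor (a i) (a j) * T.utility i j

/-- An assignment, i.e. an injective map from agents to nodes, is jump stable if no agent gains by
jumping to an empty node. -/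
def IsJumpStable [Fintype N] [DecidableEq N] (T : TDG N V) (a : N ↪ V) : Prop :=
  ∀ (i : N) (v : V), v ∉ Set.range a →
    T.agentUtility i (Function.update a i v) ≤ T.agentUtility i a

end TDG

/-- The (undirected, simple) graph `G` is a cycle. -/
def IsCycleTopology {V : Type*} (G : SimpleGraph V) : Prop :=
  ∃ m : ℕ, 3 ≤ m ∧ Nonempty (SimpleGraph.cycleGraph m ≃g G)

/-- The whole directed graph `D` is a directed cycle on `k` vertices, for `k ≥ 1`. -/
def IsDirectedCycle {N : Type*} (D : Digraph N) (k : ℕ) : Prop :=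
  ∃ e : ZMod k ≃ N, ∀ x y : ZMod k, D.Adj (e x) (e y) ↔ y = x + 1

/-! ### A random access machine with a step count

Programs act on countably many integer registers and countably many integer arrays, of which each
program mentions only finitely many. Every primitive operation (constant, register access,
array access, addition, truncated subtraction, assignment, test) costs one step. As addition and
subtraction are the only arithmetic, unit cost is polynomially equivalent to Turing machine time. -/

namespace RAM

/-- Memory: `reg x` is the value of register `x`, and `arr b k` is cell `k` of array `b`. -/
structure Mem where
  reg : ℕ → ℕ
  arr : ℕ → ℕ → ℕ

/-- Expressions. -/
inductive Term where
  | num (k : ℕ)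
  | reg (x : ℕ)
  | get (b : ℕ) (e : Term)
  | add (e₁ e₂ : Term)
  | sub (e₁ e₂ : Term)

namespace Term

def eval (s : Mem) : Term → ℕ
  | num k => k
  | reg x => s.reg x
  | get b e => s.arr b (e.eval s)
  | add e₁ e₂ => e₁.eval s + e₂.eval s
  | sub e₁ e₂ => e₁.eval s - e₂.eval s

/-- The number of primitive operations in the evaluation of an expression. -/
def cost : Term → ℕ
  | num _ => 1
  | reg _ => 1
  | get _ e => e.cost + 1
  | add e₁ e₂ => e₁.cost + e₂.cost + 1
  | sub e₁ e₂ => e₁.cost + e₂.cost + 1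

end Term

/-- Programs. Tests succeed when the value of the tested expression is not `0`. -/
inductive Prog where
  | skip
  /-- `reg x := e` -/
  | set (x : ℕ) (e : Term)
  /-- `arr b [e₁] := e₂` -/
  | put (b : ℕ) (e₁ e₂ : Term)
  | seq (c₁ c₂ : Prog)
  | cond (e : Term) (c₁ c₂ : Prog)
  | loop (e : Term) (c : Prog)

/-- `Exec c s t s'`: started in memory `s`, program `c` halts after exactly `t` steps, in memory
`s'`. -/
inductive Exec : Prog → Mem → ℕ → Mem → Prop where
  | skip (s : Mem) : Exec .skip s 1 s
  | set (s : Mem) (x : ℕ) (e : Term) :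
      Exec (.set x e) s (e.cost + 1) ⟨Function.update s.reg x (e.eval s), s.arr⟩
  | put (s : Mem) (b : ℕ) (e₁ e₂ : Term) :
      Exec (.put b e₁ e₂) s (e₁.cost + e₂.cost + 1)
        ⟨s.reg, Function.update s.arr b (Function.update (s.arr b) (e₁.eval s) (e₂.eval s))⟩
  | seq {c₁ c₂ : Prog} {s s' s'' : Mem} {t₁ t₂ : ℕ} (h₁ : Exec c₁ s t₁ s')
      (h₂ : Exec c₂ s' t₂ s'') : Exec (.seq c₁ c₂) s (t₁ + t₂) s''
  | condTrue {e : Term} {c₁ c₂ : Prog} {s s' : Mem} {t : ℕ} (he : e.eval s ≠ 0)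
      (h : Exec c₁ s t s') : Exec (.cond e c₁ c₂) s (e.cost + 1 + t) s'
  | condFalse {e : Term} {c₁ c₂ : Prog} {s s' : Mem} {t : ℕ} (he : e.eval s = 0)
      (h : Exec c₂ s t s') : Exec (.cond e c₁ c₂) s (e.cost + 1 + t) s'
  | loopDone {e : Term} {c : Prog} {s : Mem} (he : e.eval s = 0) :
      Exec (.loop e c) s (e.cost + 1) s
  | loopStep {e : Term} {c : Prog} {s s' s'' : Mem} {t₁ t₂ : ℕ} (he : e.eval s ≠ 0)
      (h₁ : Exec c s t₁ s') (h₂ : Exec (.loop e c) s' t₂ s'') :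
      Exec (.loop e c) s (e.cost + 1 + t₁ + t₂) s''

open Classical in
/-- The adjacency matrix of a relation on `{0, …, m - 1}`, written row by row: cell `v * m + w` is
`1` if `r v w` holds, and `0` otherwise. -/
noncomputable def adjacencyCells {m : ℕ} (r : Fin m → Fin m → Prop) (k : ℕ) : ℕ :=
  if ∃ v w : Fin m, k = v * m + w ∧ r v w then 1 else 0

/-- The initial memory: register `0` holds the number `n` of agents, register `1` the number `m` of
nodes, array `0` the adjacency matrix of the topology graph, and array `1` the adjacency matrix of
the friendship graph. Everything else is `0`. -/
noncomputable def input {n m : ℕ} (G : SimpleGraph (Fin m)) (F : Digraph (Fin n)) : Mem where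
  reg x := if x = 0 then n else if x = 1 then m else 0
  arr b := if b = 0 then adjacencyCells G.Adj else if b = 1 then adjacencyCells F.Adj else 0

/-- The assignment `a` is the output, written to array `2`. -/
def Outputs {n m : ℕ} (s : Mem) (a : Fin n ↪ Fin m) : Prop :=
  ∀ i : Fin n, s.arr 2 i = a i

end RAM

/-! ### Programs with bounded loops -/

namespace RAM

/-! Distance factors are positive and strictly decreasing and a cycle is connected, so an agent with
a friend wants only to be near that friend, and an agent without one is indifferent. Hence an
assignment is stable iff no empty node is closer to the friend of an agent than the agent is
(`TDG.isJumpStable_iff`). Only the functional graph "agent to friend" matters, where a friendless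
agent counts as a fixed point (`IsFriendMap`).

Necessity. Cut the topology cycle in front of an occupied node whose predecessor is empty, and
number the agents of the friendship cycle from the one at that node. For lengths 3 and 5, stability
then forces the places of the remaining agents one after the other, until some agent has a closer
empty node (`TDG.not_isDirectedCycle_three`, `TDG.not_isDirectedCycle_five`).

Sufficiency. The agents fill an interval of consecutive nodes. Every orbit ends in a cycle, and a
cycle of length `k` is put on `k` consecutive places in a zigzag (`cyclePlace`): it climbs along the
even places and returns along the odd ones. For odd `k` the climb would end with a step of two onto
the last place, next to a possibly empty node, so the two sides are exchanged from the third pair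
on. The exchange costs a downward step of three, from place 6 to place 3, which is harmless there
but would not be nearer the bottom. This needs `k ≥ 7`. For `k = 3` and `k = 5` all pairs are
exchanged, and one bad step remains, from place 2 to place 0. It becomes harmless once one more
place below place 0 is occupied.

The first cycle is laid to the left of the middle with its place 0 at the right end; later cycles
are stacked on the right, so that an occupied place lies below their place 0 (`Layout.of_cycle`,
`Layout.add_cycle`). If the first cycle has length 3 or 5 it still needs a right neighbour: an agent
off the cycles whose friend is at the right end or, if all agents are on cycles, another cycle. This
fails only when that one cycle is the whole agent set. The remaining agents are appended one at a
time, once their friends are placed, at the end of the interval closer to the friend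
(`Layout.insert_left`, `Layout.insert_right`).

Complexity. The construction is written as a `Code`, whose loops run `n`, `m` or `2 * m` times, so a
polynomial step bound is read off the syntax (`exec_compile`). Existence for abstract agent types is
deduced from the same program invariants (`exists_layout`), so the construction is verified only
once. -/

/-- The memory after the assignment `reg x := v`. -/
def Mem.setReg (s : Mem) (x v : ℕ) : Mem := ⟨Function.update s.reg x v, s.arr⟩

/-- The memory after the assignment `arr b [k] := v`. -/
def Mem.setArr (s : Mem) (b k v : ℕ) : Mem :=
  ⟨s.reg, Function.update s.arr b (Function.update (s.arr b) k v)⟩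

@[simp] theorem Mem.reg_setReg (s : Mem) (x v y : ℕ) :
    (s.setReg x v).reg y = if y = x then v else s.reg y := by
  simp [Mem.setReg, Function.update_apply]

@[simp] theorem Mem.arr_setReg (s : Mem) (x v : ℕ) : (s.setReg x v).arr = s.arr := rfl

@[simp] theorem Mem.reg_setArr (s : Mem) (b k v : ℕ) : (s.setArr b k v).reg = s.reg := rfl

@[simp] theorem Mem.arr_setArr (s : Mem) (b k v c l : ℕ) :
    (s.setArr b k v).arr c l = if c = b ∧ l = k then v else s.arr c l := by
  by_cases h : c = b
  · subst h
    by_cases h' : l = k <;> simp [Mem.setArr, h']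
  · simp [Mem.setArr, h]

/-- Programs whose loops run a number of times that is known when the loop is entered. -/
inductive Code where
  | skip
  | set (x : ℕ) (e : Term)
  | put (b : ℕ) (e₁ e₂ : Term)
  | seq (c₁ c₂ : Code)
  | ite (e : Term) (c₁ c₂ : Code)
  /-- for `reg x` from `0` to `e - 1` -/
  | rep (x : ℕ) (e : Term) (c : Code)

namespace Code

infixr:60 " ⨾ " => Code.seq

/-- The program of a code. -/
def compile : Code → Prog
  | skip => .skip
  | set x e => .set x e
  | put b e₁ e₂ => .put b e₁ e₂
  | seq c₁ c₂ => .seq c₁.compile c₂.compile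
  | ite e c₁ c₂ => .cond e c₁.compile c₂.compile
  | rep x e c => .seq (.set x (.num 0))
      (.loop (.sub e (.reg x)) (.seq c.compile (.set x (.add (.reg x) (.num 1)))))

/-- `i` rounds of the loop with counter `x` and body `f`. -/
def rounds (f : Mem → Mem) (x : ℕ) (s : Mem) : ℕ → Mem
  | 0 => s.setReg x 0
  | i + 1 => (f (rounds f x s i)).setReg x (i + 1)

/-- The final memory. -/
def run : Code → Mem → Mem
  | skip, s => s
  | set x e, s => s.setReg x (e.eval s)
  | put b e₁ e₂, s => s.setArr b (e₁.eval s) (e₂.eval s)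
  | seq c₁ c₂, s => c₂.run (c₁.run s)
  | ite e c₁ c₂, s => if e.eval s ≠ 0 then c₁.run s else c₂.run s
  | rep x e c, s => rounds c.run x s (e.eval s)

@[simp] theorem run_skip (s : Mem) : skip.run s = s := rfl

@[simp] theorem run_set (x : ℕ) (e : Term) (s : Mem) : (set x e).run s = s.setReg x (e.eval s) := rfl

@[simp] theorem run_put (b : ℕ) (e₁ e₂ : Term) (s : Mem) :
    (put b e₁ e₂).run s = s.setArr b (e₁.eval s) (e₂.eval s) := rfl

@[simp] theorem run_seq (c₁ c₂ : Code) (s : Mem) : (c₁ ⨾ c₂).run s = c₂.run (c₁.run s) := rfl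

theorem run_ite (e : Term) (c₁ c₂ : Code) (s : Mem) :
    (ite e c₁ c₂).run s = if e.eval s ≠ 0 then c₁.run s else c₂.run s := rfl

/-- The code never writes to register `y`. -/
def keepsReg (y : ℕ) : Code → Bool
  | skip => true
  | set x _ => y != x
  | put _ _ _ => true
  | seq c₁ c₂ => c₁.keepsReg y && c₂.keepsReg y
  | ite _ c₁ c₂ => c₁.keepsReg y && c₂.keepsReg y
  | rep x _ c => y != x && c.keepsReg y

/-- The code never writes to array `a`. -/
def keepsArr (a : ℕ) : Code → Bool
  | skip => true
  | set _ _ => true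
  | put b _ _ => a != b
  | seq c₁ c₂ => c₁.keepsArr a && c₂.keepsArr a
  | ite _ c₁ c₂ => c₁.keepsArr a && c₂.keepsArr a
  | rep _ _ c => c.keepsArr a

/-- Loop-invariant rule. The counter is reset explicitly in every round, so its value is available
in the step without being part of the invariant. -/
theorem rounds_induction {f : Mem → Mem} {x : ℕ} {s : Mem} {N : ℕ} (I : ℕ → Mem → Prop)
    (h0 : I 0 (s.setReg x 0))
    (hs : ∀ i s', i < N → s'.reg x = i → I i s' → I (i + 1) ((f s').setReg x (i + 1))) :
    I N (rounds f x s N) := by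
  have key : ∀ i, i ≤ N → (rounds f x s i).reg x = i ∧ I i (rounds f x s i) := by
    intro i
    induction i with
    | zero => intro _; exact ⟨by simp [rounds], h0⟩
    | succ i ih =>
      intro hi
      obtain ⟨h1, h2⟩ := ih (by omega)
      exact ⟨by simp [rounds], hs i _ (by omega) h1 h2⟩
  exact (key N le_rfl).2

theorem run_rep_induction {x : ℕ} {e : Term} {c : Code} {s : Mem} (I : ℕ → Mem → Prop)
    (h0 : I 0 (s.setReg x 0))
    (hs : ∀ i s', i < e.eval s → s'.reg x = i → I i s' →
      I (i + 1) ((c.run s').setReg x (i + 1))) :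
    I (e.eval s) ((rep x e c).run s) :=
  rounds_induction I h0 hs

theorem reg_run {y : ℕ} {c : Code} (h : c.keepsReg y = true) (s : Mem) :
    (c.run s).reg y = s.reg y := by
  induction c generalizing s with
  | skip => rfl
  | set x e =>
    have : y ≠ x := by simpa [keepsReg] using h
    simp [run, this]
  | put b e₁ e₂ => rfl
  | seq c₁ c₂ ih₁ ih₂ =>
    simp only [keepsReg, Bool.and_eq_true] at h
    rw [run, ih₂ h.2, ih₁ h.1]
  | ite e c₁ c₂ ih₁ ih₂ =>
    simp only [keepsReg, Bool.and_eq_true] at h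
    rw [run]
    split_ifs
    exacts [ih₁ h.1 s, ih₂ h.2 s]
  | rep x e c ih =>
    simp only [keepsReg, Bool.and_eq_true, bne_iff_ne] at h
    refine run_rep_induction (fun _ s' => s'.reg y = s.reg y) (by simp [h.1]) ?_
    intro i s' _ _ hI
    simp [h.1, ih h.2, hI]

theorem arr_run {a : ℕ} {c : Code} (h : c.keepsArr a = true) (s : Mem) :
    (c.run s).arr a = s.arr a := by
  induction c generalizing s with
  | skip => rfl
  | set x e => rfl
  | put b e₁ e₂ =>
    have : a ≠ b := by simpa [keepsArr] using h
    funext l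
    simp [run, this]
  | seq c₁ c₂ ih₁ ih₂ =>
    simp only [keepsArr, Bool.and_eq_true] at h
    rw [run, ih₂ h.2, ih₁ h.1]
  | ite e c₁ c₂ ih₁ ih₂ =>
    simp only [keepsArr, Bool.and_eq_true] at h
    rw [run]
    split_ifs
    exacts [ih₁ h.1 s, ih₂ h.2 s]
  | rep x e c ih =>
    simp only [keepsArr] at h
    refine run_rep_induction (fun _ s' => s'.arr a = s.arr a) rfl ?_
    intro i s' _ _ hI
    simp [ih h, hI]

/-- A loop bound: one of `n`, `m` and `2 * m`, where `n` and `m` are the sizes of the input. -/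
def isBound : Term → Bool
  | .reg x => x == 0 || x == 1
  | .add (.reg x) (.reg y) => x == 1 && y == 1
  | _ => false

/-- Loop counters are not modified by loop bodies, and all loop bounds are input sizes, which are
never overwritten. -/
def wellFormed : Code → Bool
  | skip => true
  | set x _ => 2 ≤ x
  | put _ _ _ => true
  | seq c₁ c₂ => c₁.wellFormed && c₂.wellFormed
  | ite _ c₁ c₂ => c₁.wellFormed && c₂.wellFormed
  | rep x e c => 2 ≤ x && isBound e && c.keepsReg x && c.wellFormed

theorem keepsReg_of_wellFormed {y : ℕ} (hy : y < 2) {c : Code} (h : c.wellFormed = true) :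
    c.keepsReg y = true := by
  induction c with
  | skip => rfl
  | set x e =>
    have : 2 ≤ x := by simpa [wellFormed] using h
    have : y ≠ x := by omega
    simpa [keepsReg] using this
  | put b e₁ e₂ => rfl
  | seq c₁ c₂ ih₁ ih₂ =>
    simp only [wellFormed, Bool.and_eq_true] at h
    simp [keepsReg, ih₁ h.1, ih₂ h.2]
  | ite e c₁ c₂ ih₁ ih₂ =>
    simp only [wellFormed, Bool.and_eq_true] at h
    simp [keepsReg, ih₁ h.1, ih₂ h.2]
  | rep x e c ih =>
    simp only [wellFormed, Bool.and_eq_true, decide_eq_true_eq] at h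
    have : y ≠ x := by omega
    simp [keepsReg, ih h.2, this]

theorem eval_of_isBound {e : Term} (h : isBound e = true) {s s' : Mem} (h0 : s.reg 0 = s'.reg 0)
    (h1 : s.reg 1 = s'.reg 1) : e.eval s = e.eval s' := by
  unfold isBound at h
  split at h
  · simp only [Bool.or_eq_true, beq_iff_eq] at h
    rcases h with rfl | rfl <;> simpa [Term.eval]
  · simp only [Bool.and_eq_true, beq_iff_eq] at h
    obtain ⟨rfl, rfl⟩ := h
    simp [Term.eval, h1]
  · simp at h

theorem eval_le_of_isBound {e : Term} (h : isBound e = true) (s : Mem) :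
    e.eval s ≤ 2 * (s.reg 0 + s.reg 1) := by
  unfold isBound at h
  split at h
  · simp only [Bool.or_eq_true, beq_iff_eq] at h
    rcases h with rfl | rfl <;> simp only [Term.eval] <;> omega
  · simp only [Bool.and_eq_true, beq_iff_eq] at h
    obtain ⟨rfl, rfl⟩ := h
    simp only [Term.eval]
    omega
  · simp at h

open Polynomial in
/-- A bound on the number of steps, as a polynomial in the sum of the sizes of the input. -/
noncomputable def time : Code → Polynomial ℕ
  | skip => 1
  | set _ e => C (e.cost + 1)
  | put _ e₁ e₂ => C (e₁.cost + e₂.cost + 1)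
  | seq c₁ c₂ => c₁.time + c₂.time
  | ite e c₁ c₂ => C (e.cost + 1) + c₁.time + c₂.time
  | rep _ e c => C (e.cost + 5) + 2 * X * (C (e.cost + 7) + c.time)

/-- Well-formed code never writes to registers `0` and `1`, so every loop bound keeps its initial
value and a single polynomial in `n + m` bounds all nested loops. -/
theorem exec_compile {c : Code} (h : c.wellFormed = true) (s : Mem) :
    ∃ t ≤ c.time.eval (s.reg 0 + s.reg 1), Exec c.compile s t (c.run s) := by
  induction c generalizing s with
  | skip => exact ⟨1, by simp [time], .skip s⟩
  | set x e => exact ⟨_, by simp [time], .set s x e⟩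
  | put b e₁ e₂ => exact ⟨_, by simp [time], .put s b e₁ e₂⟩
  | seq c₁ c₂ ih₁ ih₂ =>
    simp only [wellFormed, Bool.and_eq_true] at h
    obtain ⟨t₁, ht₁, e₁⟩ := ih₁ h.1 s
    obtain ⟨t₂, ht₂, e₂⟩ := ih₂ h.2 (c₁.run s)
    rw [reg_run (keepsReg_of_wellFormed (by norm_num) h.1),
      reg_run (keepsReg_of_wellFormed (by norm_num) h.1)] at ht₂
    refine ⟨t₁ + t₂, ?_, e₁.seq e₂⟩
    simp only [time, Polynomial.eval_add]
    omega
  | ite e c₁ c₂ ih₁ ih₂ =>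
    simp only [wellFormed, Bool.and_eq_true] at h
    obtain ⟨t₁, ht₁, e₁⟩ := ih₁ h.1 s
    obtain ⟨t₂, ht₂, e₂⟩ := ih₂ h.2 s
    by_cases he : e.eval s = 0
    · refine ⟨e.cost + 1 + t₂, ?_, ?_⟩
      · simp only [time, Polynomial.eval_add, Polynomial.eval_C]
        omega
      · rw [run, if_neg (by simpa using he)]
        exact .condFalse he e₂
    · refine ⟨e.cost + 1 + t₁, ?_, ?_⟩
      · simp only [time, Polynomial.eval_add, Polynomial.eval_C]
        omega
      · rw [run, if_pos he]
        exact .condTrue he e₁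
  | rep x e c ih =>
    simp only [wellFormed, Bool.and_eq_true, decide_eq_true_eq] at h
    obtain ⟨⟨⟨hx, he⟩, hcx⟩, hc⟩ := h
    set N := e.eval s with hN
    set B := s.reg 0 + s.reg 1 with hB
    have hreg : ∀ i, ∀ y < 2, (rounds c.run x s i).reg y = s.reg y := by
      intro i y hy
      have hyx : y ≠ x := by omega
      induction i with
      | zero => simp [rounds, hyx]
      | succ i ihi => simp [rounds, hyx, reg_run (keepsReg_of_wellFormed hy hc), ihi]
    have hcount : ∀ i, (rounds c.run x s i).reg x = i := by
      intro i
      cases i <;> simp [rounds]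
    have hev : ∀ i, (Term.sub e (.reg x)).eval (rounds c.run x s i) = N - i := by
      intro i
      rw [Term.eval, Term.eval, hcount, hN,
        eval_of_isBound he (hreg i 0 (by norm_num)) (hreg i 1 (by norm_num))]
    -- Induction on the number `d` of remaining rounds. The test costs `e.cost + 3` and the
    -- increment of the counter costs 4, whence `e.cost + 7` per round and `e.cost + 3` for the
    -- final failing test.
    have hloop : ∀ d i, i + d = N → ∃ t ≤ (e.cost + 3) + d * (e.cost + 7 + c.time.eval B),
        Exec (.loop (.sub e (.reg x)) (.seq c.compile (.set x (.add (.reg x) (.num 1)))))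
          (rounds c.run x s i) t (rounds c.run x s N) := by
      intro d
      induction d with
      | zero =>
        intro i hi
        obtain rfl : i = N := by omega
        refine ⟨_, ?_, .loopDone (by rw [hev, Nat.sub_self])⟩
        simp only [Term.cost]
        omega
      | succ d ihd =>
        intro i hi
        obtain ⟨t₂, ht₂, e₂⟩ := ihd (i + 1) (by omega)
        obtain ⟨t₁, ht₁, e₁⟩ := ih hc (rounds c.run x s i)
        rw [hreg i 0 (by norm_num), hreg i 1 (by norm_num)] at ht₁
        have e₃ : Exec (.set x (.add (.reg x) (.num 1))) (c.run (rounds c.run x s i))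
            ((Term.add (.reg x) (.num 1)).cost + 1)
            (rounds c.run x s (i + 1)) := by
          have := Exec.set (c.run (rounds c.run x s i)) x (.add (.reg x) (.num 1))
          have hv : (Term.add (.reg x) (.num 1)).eval (c.run (rounds c.run x s i)) = i + 1 := by
            rw [Term.eval, Term.eval, Term.eval, reg_run hcx, hcount]
          rw [hv] at this
          exact this
        refine ⟨_, ?_, .loopStep (by rw [hev]; omega) (e₁.seq e₃) e₂⟩
        have : (d + 1) * (e.cost + 7 + c.time.eval B)
            = d * (e.cost + 7 + c.time.eval B) + (e.cost + 7 + c.time.eval B) := by ring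
        rw [this]
        simp only [Term.cost]
        rw [← hB] at ht₁
        omega
    obtain ⟨t, ht, e₁⟩ := hloop N 0 (by omega)
    refine ⟨_, ?_, (Exec.set s x (.num 0)).seq e₁⟩
    have hN' : N ≤ 2 * B := eval_le_of_isBound he s
    have hmul := Nat.mul_le_mul_right (e.cost + 7 + c.time.eval B) hN'
    simp only [time, Polynomial.eval_add, Polynomial.eval_C, Polynomial.eval_mul,
      Polynomial.eval_X, Polynomial.eval_ofNat, Term.cost]
    omega

end Code

end RAM

/-! ### Stability on cycles -/

/-- The map `c` winds the integers around the cycle `G` with `m` nodes. -/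
structure IsCyclicWalk {V : Type*} (G : SimpleGraph V) (m : ℕ) (c : ℤ → V) : Prop where
  eq_iff : ∀ x y, c x = c y ↔ (m : ℤ) ∣ y - x
  adj_iff : ∀ x w, G.Adj (c x) w ↔ w = c (x + 1) ∨ w = c (x - 1)
  surjective : Function.Surjective c

namespace IsCyclicWalk

variable {V : Type*} {G : SimpleGraph V} {m : ℕ} {c : ℤ → V}

theorem exists_of_isCycleTopology [Fintype V] (h : IsCycleTopology G) :
    3 ≤ Fintype.card V ∧ ∃ c, IsCyclicWalk G (Fintype.card V) c := by
  obtain ⟨m, hm, ⟨e⟩⟩ := h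
  have hcard : Fintype.card V = m := by simpa using (Fintype.card_congr e.toEquiv).symm
  rw [hcard]
  refine ⟨hm, ?_⟩
  obtain ⟨k, rfl⟩ := Nat.exists_eq_add_of_le' hm
  let φ : ZMod (k + 3) → V := fun z => e z
  have hφ : Function.Bijective φ := e.bijective
  have hadj : ∀ u v : ZMod (k + 3), G.Adj (φ u) (φ v) ↔ u - v = 1 ∨ v - u = 1 := fun u v =>
    e.map_adj_iff.trans (SimpleGraph.cycleGraph_adj (n := k + 1) (u := u) (v := v))
  refine ⟨fun x => φ (x : ZMod (k + 3)), ?_, ?_, ?_⟩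
  · intro x y
    rw [hφ.1.eq_iff, ZMod.intCast_eq_intCast_iff_dvd_sub]
  · intro x w
    obtain ⟨z, rfl⟩ := hφ.2 w
    rw [hadj, hφ.1.eq_iff, hφ.1.eq_iff]
    push_cast
    constructor
    · rintro (h | h)
      · right; rw [← h]; ring
      · left; rw [← h]; ring
    · rintro (h | h)
      · right; rw [h]; ring
      · left; rw [h]; ring
  · intro w
    obtain ⟨z, rfl⟩ := hφ.2 w
    obtain ⟨x, rfl⟩ := ZMod.intCast_surjective z
    exact ⟨x, rfl⟩

theorem shift (h : IsCyclicWalk G m c) (a : ℤ) : IsCyclicWalk G m (fun x => c (a + x)) := by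
  refine ⟨fun x y => ?_, fun x w => ?_, fun w => ?_⟩
  · rw [h.eq_iff]; congr! 1; ring
  · rw [h.adj_iff]; congr! 3 <;> ring
  · obtain ⟨x, rfl⟩ := h.surjective w
    exact ⟨x - a, by simp⟩

theorem reflect (h : IsCyclicWalk G m c) : IsCyclicWalk G m (fun x => c (-x)) := by
  refine ⟨fun x y => ?_, fun x w => ?_, fun w => ?_⟩
  · rw [h.eq_iff, ← dvd_neg]; congr! 1; ring
  · rw [h.adj_iff, or_comm]; congr! 3 <;> ring
  · obtain ⟨x, rfl⟩ := h.surjective w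
    exact ⟨-x, by simp⟩

theorem exists_walk (h : IsCyclicWalk G m c) (x : ℤ) (d : ℕ) :
    ∃ p : G.Walk (c x) (c (x + d)), p.length = d := by
  induction d with
  | zero => exact ⟨SimpleGraph.Walk.nil.copy rfl (by simp), by simp⟩
  | succ d ih =>
    obtain ⟨p, hp⟩ := ih
    refine ⟨p.concat ((h.adj_iff _ _).2 (.inl ?_)), by simp [hp]⟩
    push_cast
    congr 1
    ring

theorem exists_walk_natAbs (h : IsCyclicWalk G m c) (x y : ℤ) :
    ∃ p : G.Walk (c x) (c y), p.length = (x - y).natAbs := by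
  rcases le_total x y with hxy | hxy
  · obtain ⟨p, hp⟩ := h.exists_walk x (x - y).natAbs
    exact ⟨p.copy rfl (by congr 1; omega), by simp [hp]⟩
  · obtain ⟨p, hp⟩ := h.exists_walk y (x - y).natAbs
    exact ⟨(p.copy rfl (by congr 1; omega)).reverse, by simp [hp]⟩

theorem dist_le (h : IsCyclicWalk G m c) (x y : ℤ) : G.dist (c x) (c y) ≤ (x - y).natAbs := by
  obtain ⟨p, hp⟩ := h.exists_walk_natAbs x y
  exact hp ▸ SimpleGraph.dist_le p

theorem reachable (h : IsCyclicWalk G m c) (v w : V) : G.Reachable v w := by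
  obtain ⟨x, rfl⟩ := h.surjective v
  obtain ⟨y, rfl⟩ := h.surjective w
  obtain ⟨p, -⟩ := h.exists_walk_natAbs x y
  exact ⟨p⟩

/-- A walk lifts to the integers, and its net displacement is at most its length. This is the lower
bound on distances that complements `dist_le`. -/
theorem exists_eq_of_walk (h : IsCyclicWalk G m c) {v w : V} (p : G.Walk v w) (x : ℤ)
    (hx : c x = v) : ∃ r : ℤ, r.natAbs ≤ p.length ∧ w = c (x + r) := by
  induction p generalizing x with
  | nil => exact ⟨0, by simp, by simp [hx]⟩
  | cons hadj p ih =>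
    subst hx
    rcases (h.adj_iff _ _).1 hadj with h' | h'
    · obtain ⟨r, hr, rfl⟩ := ih (x + 1) h'.symm
      exact ⟨r + 1, by simp only [SimpleGraph.Walk.length_cons]; omega, by congr 1; ring⟩
    · obtain ⟨r, hr, rfl⟩ := ih (x - 1) h'.symm
      exact ⟨r - 1, by simp only [SimpleGraph.Walk.length_cons]; omega, by congr 1; ring⟩

theorem exists_eq_of_dist (h : IsCyclicWalk G m c) (x : ℤ) (w : V) :
    ∃ r : ℤ, r.natAbs ≤ G.dist w (c x) ∧ w = c (x + r) := by
  obtain ⟨p, hp⟩ := (h.reachable (c x) w).exists_walk_length_eq_dist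
  rw [SimpleGraph.dist_comm, ← hp]
  exact h.exists_eq_of_walk p x rfl

end IsCyclicWalk

/-! ### Stability as a distance condition, and the two obstructions -/

namespace TDG

variable {N V : Type*}

theorem agentUtility_eq_mul [Fintype N] [DecidableEq N] {T : TDG N V} (hT : T.AtMostOneFriend)
    {i j : N} (hij : T.friendshipGraph.Adj i j) (a : N → V) :
    T.agentUtility i a = T.nodeFactor (a i) (a j) * T.utility i j := by
  have hne : j ≠ i := by
    rintro rfl
    exact absurd hij (by simp [friendshipGraph, T.utility_self])
  refine Finset.sum_eq_single_of_mem j (by simp [hne]) ?_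
  intro k _ hk
  rw [hT.2 i k fun h => hk (hT.1 i k j h hij), mul_zero]

theorem agentUtility_eq_zero [Fintype N] [DecidableEq N] {T : TDG N V} (hT : T.AtMostOneFriend)
    {i : N} (hi : ∀ j, ¬ T.friendshipGraph.Adj i j) (a : N → V) : T.agentUtility i a = 0 :=
  Finset.sum_eq_zero fun k _ => by rw [hT.2 i k (hi k), mul_zero]

/-- An assignment on a cycle is stable iff nobody can get closer to her friend. -/
theorem isJumpStable_iff [Fintype N] [DecidableEq N] {T : TDG N V} (hT : T.AtMostOneFriend)
    {m : ℕ} {c : ℤ → V} (hc : IsCyclicWalk T.topology m c) (a : N ↪ V) :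
    T.IsJumpStable a ↔ ∀ i j, T.friendshipGraph.Adj i j → ∀ v ∉ Set.range a,
      T.topology.dist (a i) (a j) ≤ T.topology.dist v (a j) := by
  have hpos : ∀ v w, v ≠ w → 1 ≤ T.topology.dist v w := fun v w hvw =>
    (hc.reachable v w).pos_dist_of_ne hvw
  have key : ∀ i j, T.friendshipGraph.Adj i j → ∀ v ∉ Set.range a,
      (T.agentUtility i (Function.update a i v) ≤ T.agentUtility i a ↔
        T.topology.dist (a i) (a j) ≤ T.topology.dist v (a j)) := by
    intro i j hij v hv
    have hne : j ≠ i := by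
      rintro rfl
      exact absurd hij (by simp [friendshipGraph, T.utility_self])
    rw [agentUtility_eq_mul hT hij, agentUtility_eq_mul hT hij, mul_le_mul_iff_left₀ hij,
      Function.update_self, Function.update_of_ne hne, nodeFactor, nodeFactor,
      if_pos (hc.reachable _ _), if_pos (hc.reachable _ _)]
    exact T.factor_strictAnti.le_iff_ge (hpos _ _ fun h => hv ⟨j, h.symm⟩)
      (hpos _ _ fun h => hne (a.injective h.symm))
  constructor
  · intro h i j hij v hv
    exact (key i j hij v hv).1 (h i v hv)
  · intro h i v hv
    by_cases hi : ∃ j, T.friendshipGraph.Adj i j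
    · obtain ⟨j, hij⟩ := hi
      exact (key i j hij v hv).2 (h i j hij v hv)
    · push Not at hi
      rw [agentUtility_eq_zero hT hi, agentUtility_eq_zero hT hi]

/-- Stability of an assignment of the agents to consecutive nodes. -/
theorem isJumpStable_of_consecutive [Fintype N] [DecidableEq N] {T : TDG N V}
    (hT : T.AtMostOneFriend) {m : ℕ} {c : ℤ → V} (hc : IsCyclicWalk T.topology m c)
    {a : N ↪ V} {P : N → ℤ} {l h : ℤ} (ha : ∀ i, a i = c (P i))
    (hocc : ∀ r, l ≤ r → r < h → ∃ i, P i = r)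
    (hleft : ∀ i j, T.friendshipGraph.Adj i j → |P i - P j| ≤ P j - l + 1)
    (hright : ∀ i j, T.friendshipGraph.Adj i j → |P i - P j| ≤ h - P j) : T.IsJumpStable a := by
  rw [isJumpStable_iff hT hc]
  intro i j hij v hv
  by_contra! hlt
  obtain ⟨r, hr, rfl⟩ := hc.exists_eq_of_dist (P j) v
  have h1 := hc.dist_le (P i) (P j)
  rw [← ha, ← ha] at h1
  rw [← ha] at hr
  simp only [Int.abs_eq_natAbs] at hleft hright
  have h2 := hleft i j hij
  have h3 := hright i j hij
  obtain ⟨k, hk⟩ := hocc (P j + r) (by omega) (by omega)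
  exact hv ⟨k, by rw [ha, hk]⟩

/-- Coordinates of the agents of a friendship cycle, measured from a node whose predecessor on the
topology cycle is empty. -/
theorem exists_coordinates [Fintype N] [DecidableEq N] {T : TDG N V} (hT : T.AtMostOneFriend)
    {m : ℕ} {c : ℤ → V} (hc : IsCyclicWalk T.topology m c) {k : ℕ} [NeZero k]
    (hk : IsDirectedCycle T.friendshipGraph k) (hm : 0 < m) {a : N ↪ V}
    (hempty : ∃ v, v ∉ Set.range a) (ha : T.IsJumpStable a) :
    ∃ p : ZMod k → ℤ, p 0 = 0 ∧ (∀ x, 0 ≤ p x ∧ p x < m - 1) ∧ Function.Injective p ∧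
      ∀ (x : ZMod k) (r : ℤ), -1 ≤ r → r < m → (∀ y, p y ≠ r) →
        (p x - p (x + 1)).natAbs ≤ (r - p (x + 1)).natAbs ∨
          m ≤ (p x - p (x + 1)).natAbs + (r - p (x + 1)).natAbs := by
  obtain ⟨e, he⟩ := hk
  have hper : ∀ x q : ℤ, c (x + m * q) = c x := fun x q =>
    ((hc.eq_iff _ _).2 ⟨q, by ring⟩).symm
  -- Go forward from an empty node to the first occupied one.
  obtain ⟨s, ⟨i₀, hi₀⟩, hs⟩ : ∃ s : ℤ, c s ∈ Set.range a ∧ c (s - 1) ∉ Set.range a := by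
    classical
    obtain ⟨v, hv⟩ := hempty
    obtain ⟨y, rfl⟩ := hc.surjective v
    have hex : ∃ d : ℕ, c (y + d) ∈ Set.range a := by
      obtain ⟨x, hx⟩ := hc.surjective (a (e 0))
      refine ⟨((x - y) % m).toNat, e 0, ?_⟩
      rw [Int.toNat_of_nonneg (Int.emod_nonneg _ (by omega)), ← hx,
        ← hper (y + _) ((x - y) / m)]
      congr 1
      have := Int.emod_add_mul_ediv (x - y) m
      linarith
    refine ⟨y + Nat.find hex, Nat.find_spec hex, ?_⟩
    cases hd : Nat.find hex with
    | zero =>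
      have := Nat.find_spec hex
      rw [hd] at this
      simp only [Nat.cast_zero, add_zero] at this
      exact absurd this hv
    | succ d =>
      have := Nat.find_min hex (m := d) (by omega)
      push_cast
      rwa [show y + ((d : ℤ) + 1) - 1 = y + d by ring]
  have hpos : ∀ i : N, ∃ p : ℤ, 0 ≤ p ∧ p < m ∧ c (s + p) = a i := by
    intro i
    obtain ⟨x, hx⟩ := hc.surjective (a i)
    refine ⟨(x - s) % m, Int.emod_nonneg _ (by omega), Int.emod_lt_of_pos _ (by omega), ?_⟩
    rw [← hx, ← hper (s + _) ((x - s) / m)]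
    congr 1
    have := Int.emod_add_mul_ediv (x - s) m
    linarith
  have hinj : ∀ x y : ℤ, c x = c y → |y - x| < m → x = y := by
    intro x y h hxy
    have := Int.eq_zero_of_abs_lt_dvd ((hc.eq_iff x y).1 h) hxy
    omega
  -- Coordinate `m - 1` is again the empty node before `s`, which gives the strict bound `p x < m -
  -- 1`.
  have hlast : c (s + (m - 1)) = c (s - 1) := by
    rw [← hper (s - 1) 1]; congr 1; ring
  choose P hP0 hPm hPa using hpos
  set x₀ := e.symm i₀ with hx₀
  -- The friendship cycle is rotated so that index `0` is the agent at `s`.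
  refine ⟨fun x => P (e (x + x₀)), ?_, fun x => ⟨hP0 _, ?_⟩, ?_, ?_⟩
  · have h1 := hPa i₀
    rw [hi₀] at h1
    have h2 := hP0 i₀
    have h3 := hPm i₀
    have := hinj _ _ h1 (by rw [abs_lt]; constructor <;> linarith)
    simp only [zero_add, hx₀, Equiv.apply_symm_apply]
    linarith
  · have h1 := hPm (e (x + x₀))
    have h2 : P (e (x + x₀)) ≠ m - 1 := by
      intro h
      have h3 := hPa (e (x + x₀))
      rw [h, hlast] at h3
      exact hs ⟨_, h3.symm⟩
    beta_reduce
    omega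
  · intro x y hxy
    have h1 : a (e (x + x₀)) = a (e (y + x₀)) := by
      rw [← hPa, ← hPa (e (y + x₀))]
      exact congrArg (fun z => c (s + z)) hxy
    simpa using a.injective h1
  · intro x r hr hrm hy
    beta_reduce at hy ⊢
    have hv : c (s + r) ∉ Set.range a := by
      rintro ⟨i, hi⟩
      rcases eq_or_lt_of_le hr with rfl | hr
      · exact hs ⟨i, hi⟩
      · rw [← hPa i] at hi
        have h2 := hP0 i
        have h3 := hPm i
        have := hinj _ _ hi (by rw [abs_lt]; constructor <;> linarith)
        apply hy (e.symm i - x₀)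
        simp only [sub_add_cancel, Equiv.apply_symm_apply]
        linarith
    have hadj : T.friendshipGraph.Adj (e (x + x₀)) (e (x + 1 + x₀)) :=
      (he _ _).2 (by ring)
    have hd := (isJumpStable_iff hT hc a).1 ha _ _ hadj _ hv
    obtain ⟨δ, hδ, h1⟩ := hc.exists_eq_of_dist (s + P (e (x + 1 + x₀))) (a (e (x + x₀)))
    rw [hPa] at hδ
    have h2 := hc.dist_le (s + r) (s + P (e (x + 1 + x₀)))
    rw [hPa] at h2
    rw [← hPa, hc.eq_iff] at h1
    obtain ⟨q, hq⟩ := h1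
    have b1 := hP0 (e (x + x₀))
    have b2 := hPm (e (x + x₀))
    have b3 := hP0 (e (x + 1 + x₀))
    have b4 := hPm (e (x + 1 + x₀))
    have b5 : δ.natAbs ≤ (r - P (e (x + 1 + x₀))).natAbs := by omega
    clear hδ h2 hd
    -- `q` counts how often a shortest path from friend to agent wraps around relative to the
    -- coordinates. Without wrapping, linear distances compare directly; with wrapping, the other
    -- way round has length at least `m` minus the linear distance.
    rcases eq_or_ne q 0 with rfl | hq0
    · left; omega
    · right
      have h5 : (m : ℤ) ≤ |(m : ℤ) * q| := by
        rw [abs_mul, Nat.abs_cast]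
        exact le_mul_of_one_le_right (by omega) (Int.one_le_abs hq0)
      rw [← hq] at h5
      rw [Int.abs_eq_natAbs] at h5
      omega

/-- Agent 2 must be adjacent to agent 0, since place `-1` is empty; then agent 1 must be at place 2;
then agent 0, two places from her friend, prefers the empty place 3. -/
theorem not_isDirectedCycle_three [Fintype N] [DecidableEq N] {T : TDG N V}
    (hT : T.AtMostOneFriend) {m : ℕ} {c : ℤ → V} (hc : IsCyclicWalk T.topology m c)
    (hm : Fintype.card N < m) {a : N ↪ V} (hempty : ∃ v, v ∉ Set.range a)
    (ha : T.IsJumpStable a) : ¬ IsDirectedCycle T.friendshipGraph 3 := by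
  intro hk
  have hcard : Fintype.card N = 3 := by
    obtain ⟨e, -⟩ := hk
    simpa [ZMod.card] using (Fintype.card_congr e).symm
  rw [hcard] at hm
  obtain ⟨p, hp0, hb, hinj, hst⟩ := exists_coordinates hT hc hk (by omega) hempty ha
  have hst' : ∀ x (r : ℤ), -1 ≤ r → r < m → p 0 ≠ r → p 1 ≠ r → p 2 ≠ r →
      (p x - p (x + 1)).natAbs ≤ (r - p (x + 1)).natAbs ∨
        m ≤ (p x - p (x + 1)).natAbs + (r - p (x + 1)).natAbs := by
    intro x r h1 h2 h3 h4 h5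
    refine hst x r h1 h2 fun y => ?_
    fin_cases y <;> assumption
  have n1 : p 0 ≠ p 1 := hinj.ne (by decide)
  have n2 : p 0 ≠ p 2 := hinj.ne (by decide)
  have n3 : p 1 ≠ p 2 := hinj.ne (by decide)
  have b1 := hb 1
  have b2 := hb 2
  have s2 := hst' 2
  have s1 := hst' 1
  have s0 := hst' 0
  rw [show (2 : ZMod 3) + 1 = 0 from rfl] at s2
  rw [show (1 : ZMod 3) + 1 = 2 from rfl] at s1
  rw [show (0 : ZMod 3) + 1 = 1 from rfl] at s0
  have e2 : p 2 = 1 := by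
    have := s2 (-1)
    omega
  have e1 : p 1 = 2 := by
    by_contra hne
    have := s1 2
    omega
  have := s0 3
  omega

/-- As for length 3, agent 4 is forced to place 1. Testing single places then leaves a short case
tree, and in every leaf the agents fill the places `0` to `4` while place 5 is a profitable jump. -/
theorem not_isDirectedCycle_five [Fintype N] [DecidableEq N] {T : TDG N V}
    (hT : T.AtMostOneFriend) {m : ℕ} {c : ℤ → V} (hc : IsCyclicWalk T.topology m c)
    (hm : Fintype.card N < m) {a : N ↪ V} (hempty : ∃ v, v ∉ Set.range a)
    (ha : T.IsJumpStable a) : ¬ IsDirectedCycle T.friendshipGraph 5 := by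
  intro hk
  have hcard : Fintype.card N = 5 := by
    obtain ⟨e, -⟩ := hk
    simpa [ZMod.card] using (Fintype.card_congr e).symm
  rw [hcard] at hm
  obtain ⟨p, hp0, hb, hinj, hst⟩ := exists_coordinates hT hc hk (by omega) hempty ha
  have hst' : ∀ x (r : ℤ), -1 ≤ r → r < m → p 0 ≠ r → p 1 ≠ r → p 2 ≠ r → p 3 ≠ r → p 4 ≠ r →
      (p x - p (x + 1)).natAbs ≤ (r - p (x + 1)).natAbs ∨
        m ≤ (p x - p (x + 1)).natAbs + (r - p (x + 1)).natAbs := by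
    intro x r h1 h2 h3 h4 h5 h6 h7
    refine hst x r h1 h2 fun y => ?_
    fin_cases y <;> assumption
  have n01 : p 0 ≠ p 1 := hinj.ne (by decide)
  have n02 : p 0 ≠ p 2 := hinj.ne (by decide)
  have n03 : p 0 ≠ p 3 := hinj.ne (by decide)
  have n04 : p 0 ≠ p 4 := hinj.ne (by decide)
  have n12 : p 1 ≠ p 2 := hinj.ne (by decide)
  have n13 : p 1 ≠ p 3 := hinj.ne (by decide)
  have n14 : p 1 ≠ p 4 := hinj.ne (by decide)
  have n23 : p 2 ≠ p 3 := hinj.ne (by decide)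
  have n24 : p 2 ≠ p 4 := hinj.ne (by decide)
  have n34 : p 3 ≠ p 4 := hinj.ne (by decide)
  have b1 := hb 1
  have b2 := hb 2
  have b3 := hb 3
  have b4 := hb 4
  have s4 := hst' 4
  have s3 := hst' 3
  have s2 := hst' 2
  have s1 := hst' 1
  have s0 := hst' 0
  rw [show (4 : ZMod 5) + 1 = 0 from rfl] at s4
  rw [show (3 : ZMod 5) + 1 = 4 from rfl] at s3
  rw [show (2 : ZMod 5) + 1 = 3 from rfl] at s2
  rw [show (1 : ZMod 5) + 1 = 2 from rfl] at s1
  rw [show (0 : ZMod 5) + 1 = 1 from rfl] at s0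
  have e4 : p 4 = 1 := by
    have := s4 (-1)
    omega
  -- The empty place `-1` is at distance 2 from agent 4, so agent 3 is at distance at most 2.
  have e3 : p 3 = 2 ∨ p 3 = 3 := by
    have := s3 (-1)
    omega
  clear hst hst' hb hinj s4
  rcases e3 with e3 | e3
  · have e21 : p 2 = 3 ∨ p 1 = 3 := by
      have := s2 3
      omega
    rcases e21 with e2 | e1
    · have e1 : p 1 = 4 := by
        have := s1 4
        omega
      have := s0 5
      omega
    · have e2 : p 2 = 4 := by
        have := s0 4
        omega
      have := s0 5
      omega
  · have e21 : p 2 = 2 ∨ p 1 = 2 := by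
      have := s3 2
      omega
    rcases e21 with e2 | e1
    · have e1 : p 1 = 4 := by
        have := s1 4
        omega
      have := s0 5
      omega
    · have e2 : p 2 = 4 := by
        have := s2 4
        omega
      have := s1 5
      omega

end TDG

/-! ### Layouts of functional graphs on an interval -/

open Function

/-- Whether the agents at distance `i` along a cycle of length `k`, on both sides of its start, are
swapped in the layout of the cycle. -/
def layoutSwap (k i : ℕ) : ℕ := if k % 2 = 1 ∧ (k ≤ 5 ∨ 3 ≤ i) then 1 else 0

/-- The place of the `t`-th agent of a cycle of length `k` in an interval of `k` places. -/
def cyclePlace (k t : ℕ) : ℕ :=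
  if 2 * t < k then 2 * t - layoutSwap k t else 2 * (k - t) - (1 - layoutSwap k (k - t))

theorem cyclePlace_lt {k t : ℕ} (ht : t < k) : cyclePlace k t < k := by
  unfold cyclePlace layoutSwap
  split_ifs <;> omega

theorem cyclePlace_inj {k t u : ℕ} (ht : t < k) (hu : u < k)
    (h : cyclePlace k t = cyclePlace k u) : t = u := by
  unfold cyclePlace layoutSwap at h
  split_ifs at h <;> omega

theorem exists_cyclePlace_eq {k q : ℕ} (hq : q < k) : ∃ t < k, cyclePlace k t = q := by
  have h := Finset.surjOn_of_injOn_of_card_le (s := Finset.range k) (t := Finset.range k)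
    (cyclePlace k) (fun t ht => by simpa using cyclePlace_lt (by simpa using ht))
    (fun t ht u hu => cyclePlace_inj (by simpa using ht) (by simpa using hu)) le_rfl
  obtain ⟨t, ht, rfl⟩ := h (by simpa using hq)
  exact ⟨t, by simpa using ht, rfl⟩

/-- The index after `t` on a cycle of length `k`. -/
def cycleSucc (k t : ℕ) : ℕ := if t + 1 = k then 0 else t + 1

theorem cycleSucc_lt {k t : ℕ} (ht : t < k) : cycleSucc k t < k := by
  unfold cycleSucc
  split_ifs <;> omega

/-- No step upwards is longer than the distance from its target to `k`, the first place above: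
climbs are by at most two, and a climb by two ends at `k - 2` or below. -/
theorem two_mul_cyclePlace_succ_le {k t : ℕ} (ht : t < k) :
    2 * cyclePlace k (cycleSucc k t) ≤ cyclePlace k t + k := by
  unfold cyclePlace layoutSwap cycleSucc
  split_ifs <;> omega

/-- The same for steps downwards, with `-2` as the first empty place below. The slack is needed only
for the step from place 2 to place 0 in the lengths 3 and 5. -/
theorem cyclePlace_le_succ {k t : ℕ} (ht : t < k) :
    cyclePlace k t ≤ 2 * cyclePlace k (cycleSucc k t) + 2 := by
  unfold cyclePlace layoutSwap cycleSucc
  split_ifs <;> omega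

/-- For the other lengths `-1` may be empty: the step to place 0 comes from place 1 (or from 0
itself if `k = 1`), and the crossing step of three ends at place 3. -/
theorem cyclePlace_le_succ' {k t : ℕ} (ht : t < k) (h3 : k ≠ 3) (h5 : k ≠ 5) :
    cyclePlace k t ≤ 2 * cyclePlace k (cycleSucc k t) + 1 := by
  unfold cyclePlace layoutSwap cycleSucc
  split_ifs <;> omega

/-! ### Orbits of a self-map of a finite initial segment -/

section Functional

variable {f : ℕ → ℕ} {n : ℕ}

theorem iterate_lt (hf : ∀ i < n, f i < n) {i : ℕ} (hi : i < n) (t : ℕ) : f^[t] i < n := by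
  induction t with
  | zero => exact hi
  | succ t ih => rw [iterate_succ_apply']; exact hf _ ih

theorem minimalPeriod_le_of_maps (hf : ∀ i < n, f i < n) {i : ℕ} (hi : i < n) :
    minimalPeriod f i ≤ n := by
  have h := Finset.card_le_card_of_injOn (s := Finset.range (minimalPeriod f i))
    (t := Finset.range n) (fun t => f^[t] i) (fun t _ => by simpa using iterate_lt hf hi t)
    (by simpa [Set.InjOn] using iterate_injOn_Iio_minimalPeriod (f := f) (x := i))
  simpa using h

/-- Pigeonhole on the first `n + 1` iterates: every agent reaches a cycle within `n` steps. -/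
theorem iterate_mem_periodicPts (hf : ∀ i < n, f i < n) {i : ℕ} (hi : i < n) :
    f^[n] i ∈ periodicPts f := by
  obtain ⟨a, ha, b, hb, hab, h⟩ := Finset.exists_ne_map_eq_of_card_lt_of_maps_to
    (s := Finset.range (n + 1)) (t := Finset.range n) (by simp) (f := fun t => f^[t] i)
    (fun t _ => by simpa using iterate_lt hf hi t)
  wlog hlt : a < b generalizing a b
  · exact this b hb a ha hab.symm h.symm (by omega)
  have hper : IsPeriodicPt f (b - a) (f^[a] i) := by
    rw [IsPeriodicPt, IsFixedPt, ← iterate_add_apply, Nat.sub_add_cancel hlt.le]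
    exact h.symm
  have ha' : a ≤ n := by have := Finset.mem_range.1 ha; omega
  have := hper.apply_iterate (n - a)
  rw [← iterate_add_apply, Nat.sub_add_cancel ha'] at this
  exact mk_mem_periodicPts (by omega) this

theorem iterate_cycleSucc {z k t : ℕ} (hk : minimalPeriod f z = k) :
    f (f^[t] z) = f^[cycleSucc k t] z := by
  rw [← iterate_succ_apply' f]
  unfold cycleSucc
  split_ifs with h
  · rw [Nat.succ_eq_add_one, h, ← hk, iterate_minimalPeriod, iterate_zero, id]
  · rfl

end Functional

/-- The agents `i < n` with `P i ≠ 0` are placed at `P i`; they fill the interval from `l` to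
`r - 1`, the friend `f i` of a placed agent `i` is placed, and no empty place is closer to `f i`
than `i`, as long as the places below `h` are counted as occupied. -/
structure Layout (f : ℕ → ℕ) (n h : ℕ) (P : ℕ → ℕ) (l r : ℕ) : Prop where
  pos : 0 < l
  le_mid : l ≤ n + 1
  mid_le : n + 1 ≤ r
  bounds : ∀ i < n, P i ≠ 0 → l ≤ P i ∧ P i < r
  occupied : ∀ q, l ≤ q → q < r → ∃ i < n, P i = q
  inj : ∀ i < n, ∀ j < n, P i ≠ 0 → P i = P j → i = j
  closed : ∀ i < n, P i ≠ 0 → P (f i) ≠ 0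
  left : ∀ i < n, P i ≠ 0 → P i + l ≤ 2 * P (f i) + 1
  right : ∀ i < n, P i ≠ 0 → 2 * P (f i) ≤ P i + max r h

namespace Layout

variable {f : ℕ → ℕ} {n h : ℕ} {P : ℕ → ℕ} {l r : ℕ}

/-- Placing is a bijection between placed agents and places. The length of the interval therefore
counts them, which keeps `l` positive and the interval shorter than the topology cycle. -/
theorem sub_eq_card (L : Layout f n h P l r) :
    r - l = ((Finset.range n).filter fun i => P i ≠ 0).card := by
  rw [← Nat.card_Ico l r]
  symm
  have hl := L.pos
  refine Finset.card_bij (fun i _ => P i) ?_ ?_ ?_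
  · intro i hi
    simp only [Finset.mem_filter, Finset.mem_range] at hi
    simpa using L.bounds i hi.1 hi.2
  · intro i hi j hj hij
    simp only [Finset.mem_filter, Finset.mem_range] at hi hj
    exact L.inj i hi.1 j hj.1 hi.2 hij
  · intro q hq
    rw [Finset.mem_Ico] at hq
    obtain ⟨i, hi, rfl⟩ := L.occupied q hq.1 hq.2
    exact ⟨i, by simp only [Finset.mem_filter, Finset.mem_range]; exact ⟨hi, by omega⟩, rfl⟩

theorem le_add (L : Layout f n h P l r) : r ≤ l + n := by
  have h1 := L.sub_eq_card
  have h2 := Finset.card_filter_le (Finset.range n) fun i => P i ≠ 0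
  rw [Finset.card_range] at h2
  omega

theorem lt_add (L : Layout f n h P l r) {i : ℕ} (hi : i < n) (h0 : P i = 0) : r < l + n := by
  have h1 := L.sub_eq_card
  have h2 : ((Finset.range n).filter fun i => P i ≠ 0).card < (Finset.range n).card :=
    Finset.card_lt_card (Finset.filter_ssubset.2 ⟨i, by simpa using hi, by simpa using h0⟩)
  rw [Finset.card_range] at h2
  omega

theorem eq_add (L : Layout f n h P l r) (hall : ∀ i < n, P i ≠ 0) : r = l + n := by
  have h1 := L.sub_eq_card
  rw [Finset.filter_true_of_mem (by simpa using hall), Finset.card_range] at h1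
  have := L.le_mid
  have := L.mid_le
  omega

/-- The last hypothesis says that `r` is no farther from the friend than `l - 1`, the first place on
the other side. Lengthening the interval only weakens the conditions on the old agents. -/
theorem insert_right (L : Layout f n h P l r) {i : ℕ} (hi : i < n) (h0 : P i = 0)
    (h1 : P (f i) ≠ 0) (hf : ∀ i < n, f i < n) (h2 : r + l ≤ 2 * P (f i) + 1) :
    Layout f n h (update P i r) l (r + 1) := by
  have hr : r ≠ 0 := by have := L.mid_le; omega
  have hPf : ∀ j < n, P j ≠ 0 → update P i r (f j) = P (f j) := by
    intro j hj hP
    refine update_of_ne ?_ _ _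
    intro h
    exact L.closed j hj hP (h ▸ h0)
  have hPi : update P i r (f i) = P (f i) := update_of_ne (fun h : f i = i => h1 (by rw [h, h0])) _ _
  have hb := L.bounds (f i) (hf i hi) h1
  have hlm := L.le_mid
  have hmr := L.mid_le
  refine ⟨L.pos, hlm, by omega, ?_, ?_, ?_, ?_, ?_, ?_⟩
  · intro j hj hP
    rcases eq_or_ne j i with rfl | hji
    · rw [update_self]; omega
    · rw [update_of_ne hji] at hP ⊢
      have := L.bounds j hj hP
      omega
  · intro q hq1 hq2
    rcases eq_or_ne q r with rfl | hqr
    · exact ⟨i, hi, update_self ..⟩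
    · obtain ⟨j, hj, rfl⟩ := L.occupied q hq1 (by omega)
      have := L.pos
      exact ⟨j, hj, update_of_ne (by rintro rfl; omega) _ _⟩
  · intro j hj j' hj' hP hPP
    rcases eq_or_ne i j with rfl | hji <;> rcases eq_or_ne i j' with rfl | hji'
    · rfl
    · rw [update_self, update_of_ne hji'.symm] at hPP
      have := L.bounds j' hj' (by omega)
      omega
    · rw [update_self, update_of_ne hji.symm] at hPP
      have := L.bounds j hj (by omega)
      omega
    · rw [update_of_ne hji.symm] at hP hPP
      rw [update_of_ne hji'.symm] at hPP
      exact L.inj j hj j' hj' hP hPP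
  · intro j hj hP
    rcases eq_or_ne j i with rfl | hji
    · rwa [hPi]
    · rw [update_of_ne hji] at hP
      rw [hPf j hj hP]
      exact L.closed j hj hP
  · intro j hj hP
    rcases eq_or_ne j i with rfl | hji
    · rw [hPi, update_self]; omega
    · rw [update_of_ne hji] at hP ⊢
      rw [hPf j hj hP]
      exact L.left j hj hP
  · intro j hj hP
    rcases eq_or_ne j i with rfl | hji
    · rw [hPi, update_self]; omega
    · rw [update_of_ne hji] at hP ⊢
      rw [hPf j hj hP]
      have := L.right j hj hP
      omega

/-- The complementary case. As `i` is not yet placed, `lt_add` gives `l > 1`, so the new place is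
not `0`, the mark of unplaced agents. -/
theorem insert_left (L : Layout f n h P l r) {i : ℕ} (hi : i < n) (h0 : P i = 0)
    (h1 : P (f i) ≠ 0) (hf : ∀ i < n, f i < n) (h2 : 2 * P (f i) + 1 < r + l) :
    Layout f n h (update P i (l - 1)) (l - 1) r := by
  have hlt := L.lt_add hi h0
  have hlm := L.le_mid
  have hmr := L.mid_le
  have hPf : ∀ j < n, P j ≠ 0 → update P i (l - 1) (f j) = P (f j) := by
    intro j hj hP
    refine update_of_ne ?_ _ _
    intro h
    exact L.closed j hj hP (h ▸ h0)
  have hPi : update P i (l - 1) (f i) = P (f i) := update_of_ne (fun h : f i = i => h1 (by rw [h, h0])) _ _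
  have hb := L.bounds (f i) (hf i hi) h1
  refine ⟨by omega, by omega, hmr, ?_, ?_, ?_, ?_, ?_, ?_⟩
  · intro j hj hP
    rcases eq_or_ne j i with rfl | hji
    · rw [update_self]; omega
    · rw [update_of_ne hji] at hP ⊢
      have := L.bounds j hj hP
      omega
  · intro q hq1 hq2
    rcases eq_or_ne q (l - 1) with rfl | hqr
    · exact ⟨i, hi, update_self ..⟩
    · obtain ⟨j, hj, rfl⟩ := L.occupied q (by omega) hq2
      exact ⟨j, hj, update_of_ne (by rintro rfl; omega) _ _⟩
  · intro j hj j' hj' hP hPP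
    rcases eq_or_ne i j with rfl | hji <;> rcases eq_or_ne i j' with rfl | hji'
    · rfl
    · rw [update_self, update_of_ne hji'.symm] at hPP
      have := L.bounds j' hj' (by omega)
      omega
    · rw [update_self, update_of_ne hji.symm] at hPP
      have := L.bounds j hj (by omega)
      omega
    · rw [update_of_ne hji.symm] at hP hPP
      rw [update_of_ne hji'.symm] at hPP
      exact L.inj j hj j' hj' hP hPP
  · intro j hj hP
    rcases eq_or_ne j i with rfl | hji
    · rwa [hPi]
    · rw [update_of_ne hji] at hP
      rw [hPf j hj hP]
      exact L.closed j hj hP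
  · intro j hj hP
    rcases eq_or_ne j i with rfl | hji
    · rw [hPi, update_self]; omega
    · rw [update_of_ne hji] at hP ⊢
      rw [hPf j hj hP]
      have := L.left j hj hP
      omega
  · intro j hj hP
    rcases eq_or_ne j i with rfl | hji
    · rw [hPi, update_self]; omega
    · rw [update_of_ne hji] at hP ⊢
      rw [hPf j hj hP]
      exact L.right j hj hP

/-- A layout of one cycle, which needs an occupied place above it if its length is `3` or `5`. -/
theorem of_cycle {z k : ℕ} (hf : ∀ i < n, f i < n) (hz : z < n) (hk : minimalPeriod f z = k)
    (hk0 : 0 < k) (hcyc : ∀ t < k, P (f^[t] z) = n - cyclePlace k t)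
    (hrest : ∀ j, (∀ t < k, j ≠ f^[t] z) → P j = 0) (hh : k = 3 ∨ k = 5 → n + 2 ≤ h) :
    Layout f n h P (n + 1 - k) (n + 1) := by
  have hkn : k ≤ n := hk ▸ minimalPeriod_le_of_maps hf hz
  have horb : ∀ j, P j ≠ 0 → ∃ t < k, j = f^[t] z := by
    intro j hj
    by_contra! h
    exact hj (hrest j h)
  have hnext : ∀ t < k, P (f (f^[t] z)) = n - cyclePlace k (cycleSucc k t) := fun t ht => by
    rw [iterate_cycleSucc hk, hcyc _ (cycleSucc_lt ht)]
  refine ⟨by omega, by omega, le_rfl, ?_, ?_, ?_, ?_, ?_, ?_⟩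
  · intro j _ hP
    obtain ⟨t, ht, rfl⟩ := horb j hP
    have := cyclePlace_lt ht
    rw [hcyc t ht]
    omega
  · intro q hq1 hq2
    obtain ⟨t, ht, h⟩ := exists_cyclePlace_eq (k := k) (q := n - q) (by omega)
    exact ⟨_, iterate_lt hf hz t, by rw [hcyc t ht]; omega⟩
  · intro j _ j' _ hP hPP
    obtain ⟨t, ht, rfl⟩ := horb j hP
    obtain ⟨u, hu, rfl⟩ := horb j' (hPP ▸ hP)
    rw [hcyc t ht, hcyc u hu] at hPP
    have h1 := cyclePlace_lt ht
    have h2 := cyclePlace_lt hu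
    rw [cyclePlace_inj ht hu (by omega)]
  · intro j _ hP
    obtain ⟨t, ht, rfl⟩ := horb j hP
    have := cyclePlace_lt (cycleSucc_lt ht)
    rw [hnext t ht]
    omega
  · intro j _ hP
    obtain ⟨t, ht, rfl⟩ := horb j hP
    have := cyclePlace_lt (cycleSucc_lt ht)
    have := two_mul_cyclePlace_succ_le ht
    rw [hnext t ht, hcyc t ht]
    omega
  · intro j _ hP
    obtain ⟨t, ht, rfl⟩ := horb j hP
    have := cyclePlace_lt ht
    have h1 := cyclePlace_le_succ ht
    rw [hnext t ht, hcyc t ht]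
    -- The layout is mirrored, so the first place beyond `cyclePlace` `0` is `n + 1`. For these two
    -- lengths it must count as occupied, hence `n + 2 ≤ h`.
    by_cases hk35 : k = 3 ∨ k = 5
    · have := hh hk35
      omega
    · have := cyclePlace_le_succ' ht (by omega) (by omega)
      omega

/-- A cycle can be added to a nonempty layout. -/
theorem add_cycle (L : Layout f n h P l r) (hlr : l < r) {z k : ℕ} (hf : ∀ i < n, f i < n)
    (hz : z < n) (hk : minimalPeriod f z = k) (hPz : P z = 0) {P' : ℕ → ℕ}
    (hcyc : ∀ t < k, P' (f^[t] z) = r + cyclePlace k t)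
    (hrest : ∀ j, (∀ t < k, j ≠ f^[t] z) → P' j = P j) :
    Layout f n h P' l (r + k) := by
  have hl := L.pos
  have hlm := L.le_mid
  have hmr := L.mid_le
  -- Placed agents are closed under `f`, so one placed agent on the cycle would force `z` to be
  -- placed.
  have horb0 : ∀ t < k, P (f^[t] z) = 0 := by
    intro t ht
    by_contra h0
    have h1 : ∀ s, P (f^[s] (f^[t] z)) ≠ 0 := by
      intro s
      induction s with
      | zero => exact h0
      | succ s ih =>
        rw [iterate_succ_apply']
        exact L.closed _ (iterate_lt hf (iterate_lt hf hz t) s) ih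
    have h2 := h1 (k - t)
    rw [← iterate_add_apply, Nat.sub_add_cancel ht.le, ← hk, iterate_minimalPeriod] at h2
    exact h2 hPz
  have hold : ∀ j, P j ≠ 0 → P' j = P j := fun j hj =>
    hrest j fun t ht h => hj (h ▸ horb0 t ht)
  have hcases : ∀ j, P' j ≠ 0 → (∃ t < k, j = f^[t] z) ∨ (P j ≠ 0 ∧ P' j = P j) := by
    intro j hj
    by_cases h : ∃ t < k, j = f^[t] z
    · exact .inl h
    · push Not at h
      rw [hrest j h] at hj ⊢
      exact .inr ⟨hj, rfl⟩
  have hnext : ∀ t < k, P' (f (f^[t] z)) = r + cyclePlace k (cycleSucc k t) := fun t ht => by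
    rw [iterate_cycleSucc hk, hcyc _ (cycleSucc_lt ht)]
  refine ⟨hl, hlm, by omega, ?_, ?_, ?_, ?_, ?_, ?_⟩
  · intro j hj hP
    rcases hcases j hP with ⟨t, ht, rfl⟩ | ⟨h1, h2⟩
    · have := cyclePlace_lt ht
      rw [hcyc t ht]
      omega
    · have := L.bounds j hj h1
      omega
  · intro q hq1 hq2
    by_cases hq : q < r
    · obtain ⟨j, hj, rfl⟩ := L.occupied q hq1 hq
      exact ⟨j, hj, hold j (by omega)⟩
    · obtain ⟨t, ht, h⟩ := exists_cyclePlace_eq (k := k) (q := q - r) (by omega)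
      exact ⟨_, iterate_lt hf hz t, by rw [hcyc t ht]; omega⟩
  · intro j hj j' hj' hP hPP
    rcases hcases j hP with ⟨t, ht, rfl⟩ | ⟨h1, h2⟩ <;>
      rcases hcases j' (hPP ▸ hP) with ⟨u, hu, rfl⟩ | ⟨h3, h4⟩
    · rw [hcyc t ht, hcyc u hu] at hPP
      rw [cyclePlace_inj ht hu (by omega)]
    · rw [hcyc t ht] at hPP
      have := L.bounds j' hj' h3
      omega
    · rw [hcyc u hu] at hPP
      have := L.bounds j hj h1
      omega
    · exact L.inj j hj j' hj' h1 (by omega)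
  · intro j hj hP
    rcases hcases j hP with ⟨t, ht, rfl⟩ | ⟨h1, h2⟩
    · rw [hnext t ht]
      omega
    · have h3 := L.closed j hj h1
      rwa [hold _ h3]
  · intro j hj hP
    rcases hcases j hP with ⟨t, ht, rfl⟩ | ⟨h1, h2⟩
    -- Here `hlr` is used: the occupied place `r - 1` below the new cycle absorbs the slack of
    -- lengths 3 and 5.
    · have := cyclePlace_le_succ ht
      rw [hnext t ht, hcyc t ht]
      omega
    · have h3 := L.left j hj h1
      rwa [hold _ (L.closed j hj h1), h2]
  · intro j hj hP
    rcases hcases j hP with ⟨t, ht, rfl⟩ | ⟨h1, h2⟩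
    · have := two_mul_cyclePlace_succ_le ht
      rw [hnext t ht, hcyc t ht]
      omega
    · have h3 := L.right j hj h1
      rw [hold _ (L.closed j hj h1), h2]
      omega

end Layout

/-! ### The program -/

namespace RAM

open Function Code

@[simp] theorem Mem.setArr_setArr (s : Mem) (b k u v : ℕ) :
    (s.setArr b k u).setArr b k v = s.setArr b k v := by
  simp [Mem.setArr]

@[simp] theorem Mem.setArr_self (s : Mem) (b k : ℕ) : s.setArr b k (s.arr b k) = s := by
  simp [Mem.setArr]

theorem Mem.setReg_setArr (s : Mem) (x w b k v : ℕ) :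
    (s.setArr b k v).setReg x w = (s.setReg x w).setArr b k v := rfl

@[simp] theorem Mem.setReg_setReg (s : Mem) (x v w : ℕ) :
    (s.setReg x v).setReg x w = s.setReg x w := by
  simp [Mem.setReg]

/-- A loop that stores the last counter value with property `A` in a memory cell. -/
theorem run_search {x : ℕ} {e : Term} {c : Code} {s : Mem} {b k : ℕ} (A : ℕ → Prop)
    [DecidablePred A]
    (hc : ∀ v < e.eval s, ∀ u, c.run ((s.setReg x v).setArr b k u) =
      (s.setReg x v).setArr b k (if A v then v else u)) :
    ∃ u, (rep x e c).run s = (s.setReg x (e.eval s)).setArr b k u ∧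
      ((∃ v < e.eval s, A v) → A u ∧ u < e.eval s) ∧
      ((∀ v < e.eval s, ¬ A v) → u = s.arr b k) := by
  refine run_rep_induction (fun i s' => ∃ u, s' = (s.setReg x i).setArr b k u ∧
    ((∃ v < i, A v) → A u ∧ u < i) ∧ ((∀ v < i, ¬ A v) → u = s.arr b k)) ?_ ?_
  · exact ⟨s.arr b k, ((s.setReg x 0).setArr_self b k).symm, by simp, by simp⟩
  · rintro i s' hi - ⟨u, rfl, h1, h2⟩
    rw [hc i hi, Mem.setReg_setArr, Mem.setReg_setReg]
    refine ⟨_, rfl, ?_, ?_⟩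
    · rintro ⟨v, hv, hA⟩
      split_ifs with hi'
      · exact ⟨hi', by omega⟩
      · have hvi : v ≠ i := by rintro rfl; exact hi' hA
        have := h1 ⟨v, by omega, hA⟩
        exact ⟨this.1, by omega⟩
    · intro h
      rw [if_neg (h i (by omega))]
      exact h2 fun v hv => h v (by omega)

/-- Tabulates the multiples of `reg x` in array `b`. -/
def multiplesCode (b x : ℕ) : Code :=
  rep 2 (.reg x) (put b (.add (.reg 2) (.num 1)) (.add (.get b (.reg 2)) (.reg x)))

theorem run_multiplesCode {b x : ℕ} (hx : x ≠ 2) {s : Mem} (hb : s.arr b = 0) :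
    ∀ k ≤ s.reg x, ((multiplesCode b x).run s).arr b k = k * s.reg x := by
  change ∀ k ≤ (Term.reg x).eval s, _
  refine (run_rep_induction (s := s) (x := 2) (e := .reg x) (fun i s' => s'.reg x = s.reg x ∧
    ∀ k ≤ i, s'.arr b k = k * s.reg x) ?_ ?_).2
  · simp [hx, hb]
  · rintro i s' _ h2 ⟨h, hI⟩
    refine ⟨by simp [run, hx, h], fun k hk => ?_⟩
    rcases eq_or_ne k (i + 1) with rfl | hki
    · simp [run, Term.eval, h2, hI i le_rfl, h]
      ring
    · simp [run, Term.eval, h2, hki, hI k (by omega)]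

/-- Tabulates the parities of `0, …, n` in array `6`. -/
def parityCode : Code :=
  rep 2 (.reg 0) (put 6 (.add (.reg 2) (.num 1)) (.sub (.num 1) (.get 6 (.reg 2))))

theorem run_parityCode {s : Mem} (hb : s.arr 6 = 0) :
    ∀ k ≤ s.reg 0, (parityCode.run s).arr 6 k = k % 2 := by
  change ∀ k ≤ (Term.reg 0).eval s, _
  refine run_rep_induction (s := s) (x := 2) (e := .reg 0) (fun i s' => ∀ k ≤ i, s'.arr 6 k = k % 2) ?_ ?_
  · simp [hb]
  · intro i s' _ h2 hI k hk
    rcases eq_or_ne k (i + 1) with rfl | hki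
    · simp [run, Term.eval, h2, hI i le_rfl]
      omega
    · simp [run, Term.eval, h2, hki, hI k (by omega)]

theorem adjacencyCells_ne_zero {m : ℕ} {r : Fin m → Fin m → Prop} {v w : Fin m} :
    adjacencyCells r (v * m + w) ≠ 0 ↔ r v w := by
  unfold adjacencyCells
  have hm : 0 < m := v.pos
  have key : ∀ v' w' : Fin m, (v : ℕ) * m + w = v' * m + w' → v = v' ∧ w = w' := by
    intro v' w' h
    have h1 := congrArg (· / m) h
    have h2 := congrArg (· % m) h
    simp only [mul_comm _ m, Nat.mul_add_div hm, Nat.mul_add_mod,  Nat.div_eq_of_lt w.2, Nat.div_eq_of_lt w'.2, Nat.mod_eq_of_lt w.2,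
      Nat.mod_eq_of_lt w'.2, add_zero] at h1 h2
    exact ⟨Fin.ext h1, Fin.ext h2⟩
  split_ifs with h
  · obtain ⟨v', w', h1, h2⟩ := h
    obtain ⟨rfl, rfl⟩ := key v' w' h1
    simpa using h2
  · simp only [ne_eq, not_true_eq_false, false_iff]
    exact fun hr => h ⟨v, w, rfl, hr⟩

/-- Walks twice around the topology cycle, and writes the nodes to array `3`. -/
def walkCode : Code :=
  rep 2 (.reg 1) (ite (.get 0 (.reg 2)) (put 3 (.num 1) (.reg 2)) skip) ⨾
  rep 2 (.add (.reg 1) (.reg 1)) (rep 3 (.reg 1)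
    (ite (.get 0 (.add (.get 8 (.get 3 (.add (.reg 2) (.num 1)))) (.reg 3)))
      (ite (.add (.sub (.reg 3) (.get 3 (.reg 2))) (.sub (.get 3 (.reg 2)) (.reg 3)))
        (put 3 (.add (.reg 2) (.num 2)) (.reg 3)) skip) skip))

/-- A walk on a cycle is determined by its first two nodes, as the next node is the neighbour of the
current one that differs from the previous one. Shifting and possibly reflecting `c₀` makes it start
like the computed walk. -/
theorem run_walkCode {m : ℕ} {G : SimpleGraph (Fin m)} (hm : 3 ≤ m) {c₀ : ℤ → Fin m}
    (hc₀ : IsCyclicWalk G m c₀) {s : Mem} (h1 : s.reg 1 = m)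
    (h0 : s.arr 0 = adjacencyCells G.Adj) (h8 : ∀ k ≤ m, s.arr 8 k = k * m)
    (h3 : s.arr 3 = 0) :
    ∃ c : ℤ → Fin m, IsCyclicWalk G m c ∧
      ∀ j < 2 * m + 2, (walkCode.run s).arr 3 j = c (j : ℕ) := by
  classical
  have : NeZero m := ⟨by omega⟩
  obtain ⟨a, ha⟩ := hc₀.surjective 0
  have hadj0 : ∀ w : Fin m, adjacencyCells G.Adj w ≠ 0 ↔ G.Adj 0 w := by
    intro w
    have := adjacencyCells_ne_zero (r := G.Adj) (v := 0) (w := w)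
    simpa using this
  obtain ⟨u, hu, hu1, -⟩ := run_search (x := 2) (e := .reg 1)
    (c := ite (.get 0 (.reg 2)) (put 3 (.num 1) (.reg 2)) skip) (s := s) (b := 3) (k := 1)
    (fun v => adjacencyCells G.Adj v ≠ 0) (by
      intro v hv u
      simp only [run, Term.eval, Mem.arr_setArr, Mem.reg_setArr, Mem.reg_setReg,
        Mem.arr_setReg, h0, Mem.setArr_setArr]
      simp only [OfNat.zero_ne_ofNat, false_and, if_false, if_true]
      split_ifs <;> rfl)
  rw [Term.eval, h1] at hu hu1
  have hadja : G.Adj 0 (c₀ (a + 1)) := ha ▸ (hc₀.adj_iff _ _).2 (.inl rfl)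
  obtain ⟨hu2, hum⟩ := hu1 ⟨c₀ (a + 1), (c₀ (a + 1)).2, (hadj0 _).2 hadja⟩
  have hu3 : G.Adj 0 ⟨u, hum⟩ := (hadj0 ⟨u, hum⟩).1 hu2
  obtain ⟨c, hc, hc0, hc1⟩ : ∃ c, IsCyclicWalk G m c ∧ c 0 = 0 ∧ c 1 = ⟨u, hum⟩ := by
    rw [← ha] at hu3
    rcases (hc₀.adj_iff _ _).1 hu3 with h | h
    · exact ⟨_, hc₀.shift a, by simp [ha], by simp [h]⟩
    · exact ⟨_, (hc₀.shift a).reflect, by simp [ha], by simp [h, sub_eq_add_neg]⟩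
  refine ⟨c, hc, ?_⟩
  set s₁ := (rep 2 (.reg 1) (ite (.get 0 (.reg 2)) (put 3 (.num 1) (.reg 2)) skip)).run s with hs₁
  have e1 : s₁.reg 1 = m := by rw [hu]; simp [h1]
  have hN : (Term.add (.reg 1) (.reg 1)).eval s₁ = 2 * m := by
    simp only [Term.eval, e1]; omega
  rw [walkCode, run, ← hs₁, ← hN]
  refine (run_rep_induction (fun i s' => s'.reg 1 = m ∧ s'.arr 0 = adjacencyCells G.Adj ∧
    s'.arr 8 = s.arr 8 ∧ ∀ j < i + 2, s'.arr 3 j = c (j : ℕ)) ?_ ?_).2.2.2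
  · refine ⟨by simp [e1], ?_, ?_, ?_⟩
    · rw [hu]; funext j; simp [h0]
    · rw [hu]; funext j; simp
    · intro j hj
      rw [hu]
      interval_cases j
      · simp [h3, hc0]
      · simp [hc1]
  -- The two truncated differences in the test add up to `0` iff the candidate equals the node
  -- before the current one; `m ≥ 3` ensures that the successor passes this test.
  · rintro i s' hi hx ⟨i1, i0, i8, i3⟩
    have hne : c (i + 2) ≠ c i := by
      intro h
      have := (hc.eq_iff _ _).1 h
      have := Int.eq_zero_of_abs_lt_dvd this (by
        rw [show (i : ℤ) - (i + 2) = -2 by ring]; simp; omega)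
      omega
    have hA : ∀ v : Fin m, G.Adj (c (i + 1)) v ∧ v ≠ c i ↔ v = c (i + 2) := by
      intro v
      rw [hc.adj_iff, show (i : ℤ) + 1 + 1 = i + 2 by ring, show (i : ℤ) + 1 - 1 = i by ring]
      constructor
      · rintro ⟨h | h, h'⟩
        exacts [h, absurd h h']
      · rintro rfl
        exact ⟨.inl rfl, hne⟩
    have c0 : s'.arr 3 i = c i := i3 i (by omega)
    have c1 : s'.arr 3 (i + 1) = c (i + 1) := by
      rw [i3 (i + 1) (by omega)]; push_cast; rfl
    obtain ⟨w, hw, hw1, -⟩ := run_search (x := 3) (e := .reg 1)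
      (c := ite (.get 0 (.add (.get 8 (.get 3 (.add (.reg 2) (.num 1)))) (.reg 3)))
        (ite (.add (.sub (.reg 3) (.get 3 (.reg 2))) (.sub (.get 3 (.reg 2)) (.reg 3)))
          (put 3 (.add (.reg 2) (.num 2)) (.reg 3)) skip) skip) (s := s') (b := 3) (k := i + 2)
      (fun v => v = c (i + 2)) (by
        intro v hv u
        rw [Term.eval, i1] at hv
        have hA' := hA ⟨v, hv⟩
        rw [← adjacencyCells_ne_zero (r := G.Adj), ← Fin.val_ne_iff, Fin.ext_iff] at hA'
        simp only at hA'
        simp only [run, Term.eval, Mem.arr_setArr, Mem.reg_setArr, Mem.reg_setReg,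
          Mem.arr_setReg, i0, hx, i8]
        norm_num [c0, c1]
        rw [h8 _ (c (i + 1)).2.le]
        generalize adjacencyCells G.Adj _ = z at *
        split_ifs <;> first | rfl | (exfalso; omega))
    rw [Term.eval, i1] at hw hw1
    obtain ⟨rfl, -⟩ := hw1 ⟨c (i + 2), (c (i + 2)).2, rfl⟩
    rw [hw]
    refine ⟨by simp [i1], ?_, ?_, ?_⟩
    · funext j; simp [i0]
    · funext j; simp [i8]
    · intro j hj
      rcases eq_or_ne j (i + 2) with rfl | hji
      · simp
      · simp [hji, i3 j (by omega)]

/-- Writes the friends of all agents to array `4`; an agent without friend is her own friend. -/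
def friendCode : Code :=
  rep 2 (.reg 0) (put 4 (.reg 2) (.reg 2) ⨾
    rep 3 (.reg 0) (ite (.get 1 (.add (.get 9 (.reg 2)) (.reg 3))) (put 4 (.reg 2) (.reg 3)) skip))

theorem run_friendCode {n : ℕ} {s : Mem} (h0 : s.reg 0 = n) (h9 : ∀ k ≤ n, s.arr 9 k = k * n) :
    ∀ i < n, (friendCode.run s).arr 4 i < n ∧
      ((∃ j < n, s.arr 1 (i * n + j) ≠ 0) →
        s.arr 1 (i * n + (friendCode.run s).arr 4 i) ≠ 0) ∧
      ((∀ j < n, s.arr 1 (i * n + j) = 0) → (friendCode.run s).arr 4 i = i) := by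
  have hN : (Term.reg 0).eval s = n := h0
  refine (run_rep_induction (s := s) (x := 2) (e := .reg 0) (fun i s' => s'.reg 0 = n ∧
    s'.arr 1 = s.arr 1 ∧ s'.arr 9 = s.arr 9 ∧ ∀ i' < i, s'.arr 4 i' < n ∧
      ((∃ j < n, s.arr 1 (i' * n + j) ≠ 0) → s.arr 1 (i' * n + s'.arr 4 i') ≠ 0) ∧
      ((∀ j < n, s.arr 1 (i' * n + j) = 0) → s'.arr 4 i' = i')) ?_ ?_).2.2.2
    |> fun h => by rwa [hN] at h
  · simp [h0]
  · rintro i s' hi hx ⟨i0, i1, i9, i4⟩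
    rw [hN] at hi
    obtain ⟨u, hu, hu1, hu2⟩ := run_search (x := 3) (e := .reg 0)
      (c := ite (.get 1 (.add (.get 9 (.reg 2)) (.reg 3))) (put 4 (.reg 2) (.reg 3)) skip)
      (s := s'.setArr 4 i i) (b := 4) (k := i) (fun v => s.arr 1 (i * n + v) ≠ 0) (by
        intro v hv u
        simp only [run, Term.eval, Mem.arr_setArr, Mem.reg_setArr, Mem.reg_setReg,
          Mem.arr_setReg, i1, i9, hx]
        norm_num [hx, h9 i hi.le]
        split_ifs <;> simp)
    simp only [run, Term.eval, hx] at hu ⊢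
    rw [hu]
    simp only [Term.eval, Mem.reg_setArr, i0] at hu1 hu2
    refine ⟨by simp [i0], ?_, ?_, ?_⟩
    · funext j; simp [i1]
    · funext j; simp [i9]
    · intro j hj
      rcases eq_or_ne j i with rfl | hji
      · simp only [Mem.arr_setReg, Mem.arr_setArr, and_self, if_true]
        refine ⟨?_, fun h => (hu1 h).1, fun h => ?_⟩
        · by_cases h : ∃ v < n, s.arr 1 (j * n + v) ≠ 0
          · exact (hu1 h).2
          · rw [hu2 (by simpa using h)]
            simpa using hi
        · rw [hu2 (by simpa using h)]
          simp
      · simpa [hji] using i4 j (by omega)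

/-- One step along the friendship graph from the agent in register `4`, in the computation of the
length of the cycle of the agent in register `2`. -/
def periodStep : Code :=
  set 4 (.get 4 (.reg 4)) ⨾
    ite (.add (.get 5 (.reg 2)) (.add (.sub (.reg 4) (.reg 2)) (.sub (.reg 2) (.reg 4)))) skip
      (put 5 (.reg 2) (.add (.reg 3) (.num 1)))

theorem run_periodStep (s : Mem) : periodStep.run s =
    if s.arr 5 (s.reg 2) = 0 ∧ s.arr 4 (s.reg 4) = s.reg 2 then
      (s.setReg 4 (s.arr 4 (s.reg 4))).setArr 5 (s.reg 2) (s.reg 3 + 1)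
    else s.setReg 4 (s.arr 4 (s.reg 4)) := by
  simp only [periodStep, run_seq, run_set, run_ite, run_skip, run_put, Term.eval, Mem.reg_setReg,
    Mem.arr_setReg]
  norm_num
  split_ifs <;> first | rfl | omega

/-- Writes the lengths of the friendship cycles of the agents to array `5`, with `0` for agents that
are not on a cycle. -/
def periodCode : Code :=
  rep 2 (.reg 0) (set 4 (.reg 2) ⨾ rep 3 (.reg 0) periodStep)

theorem run_rep_periodStep {n : ℕ} {f : ℕ → ℕ} (hf : ∀ i < n, f i < n) {s : Mem} {i : ℕ}
    (hi : i < n) (h0 : s.reg 0 = n) (h2 : s.reg 2 = i) (h4 : s.reg 4 = i) (hf4 : s.arr 4 = f)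
    (h5 : s.arr 5 i = 0) :
    (∀ j ≠ i, ((rep 3 (.reg 0) periodStep).run s).arr 5 j = s.arr 5 j) ∧
      ((rep 3 (.reg 0) periodStep).run s).arr 5 i = minimalPeriod f i := by
  have hN : (Term.reg 0).eval s = n := h0
  -- The cell is written only at the first return to `i`. An agent off the cycles never returns, and
  -- the initial `0` agrees with `minimalPeriod f i = 0`.
  obtain ⟨-, -, -, h, h'⟩ := run_rep_induction (s := s) (x := 3) (e := .reg 0) (c := periodStep)
    (fun t s' => s'.reg 2 = i ∧ s'.arr 4 = f ∧ s'.reg 4 = f^[t] i ∧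
      (∀ j ≠ i, s'.arr 5 j = s.arr 5 j) ∧
      s'.arr 5 i = if minimalPeriod f i ≤ t then minimalPeriod f i else 0)
    (by simp only [nonpos_iff_eq_zero]; split_ifs <;> simp [*]) (by
      rintro t s' - htx ⟨k2, kf, k4, k5, k5'⟩
      rw [run_periodStep, kf, k4, k2, ← iterate_succ_apply' f t i, Nat.succ_eq_add_one, htx, k5']
      have hp : f^[t + 1] i = i → 0 < minimalPeriod f i ∧ minimalPeriod f i ≤ t + 1 := fun h =>
        have h' : IsPeriodicPt f (t + 1) i := h
        ⟨h'.minimalPeriod_pos (by omega), h'.minimalPeriod_le (by omega)⟩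
      have hp' : minimalPeriod f i = t + 1 → f^[t + 1] i = i := fun h => h ▸ iterate_minimalPeriod
      generalize f^[t + 1] i = w at *
      split_ifs with h1 h2 h3 h4 <;> (first | (exfalso; omega) | skip)
      all_goals
        refine ⟨by simp [k2], ?_, by simp, ?_, ?_⟩
        · funext j; simp [kf]
        · intro j hj; simp [hj, k5 j hj]
        · simp [k5']
          try omega)
  rw [hN, if_pos (minimalPeriod_le_of_maps hf hi)] at h'
  exact ⟨h, h'⟩

theorem run_periodCode {n : ℕ} {f : ℕ → ℕ} (hf : ∀ i < n, f i < n) {s : Mem} (h0 : s.reg 0 = n)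
    (h4 : s.arr 4 = f) (h5 : s.arr 5 = 0) :
    ∀ i < n, (periodCode.run s).arr 5 i = minimalPeriod f i := by
  have hN : (Term.reg 0).eval s = n := h0
  rw [← hN]
  refine (run_rep_induction (s := s) (x := 2) (e := .reg 0) (fun i s' => s'.reg 0 = n ∧
    s'.arr 4 = f ∧ (∀ j, i ≤ j → s'.arr 5 j = 0) ∧ ∀ j < i, s'.arr 5 j = minimalPeriod f j)
    ?_ ?_).2.2.2
  · simp [h0, h4, h5]
  · rintro i s' hi hx ⟨i0, i4, i5, i5'⟩
    rw [hN] at hi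
    obtain ⟨h, h'⟩ := run_rep_periodStep hf hi (s := s'.setReg 4 i) (by simpa) (by simpa) (by simp)
      (by simpa) (by simpa using i5 i le_rfl)
    simp only [run_seq, run_set, Term.eval, hx]
    refine ⟨?_, ?_, ?_, ?_⟩
    · rw [Mem.reg_setReg, if_neg (by norm_num), reg_run (by decide)]
      simpa
    · rw [Mem.arr_setReg, arr_run (by decide)]
      simpa
    · intro j hj
      rw [Mem.arr_setReg, h j (by omega), Mem.arr_setReg, i5 j (by omega)]
    · intro j hj
      rcases eq_or_ne j i with rfl | hji
      · exact h'
      · rw [Mem.arr_setReg, h j hji, Mem.arr_setReg, i5' j (by omega)]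

end RAM

/-! ### Placing cycles and appending the remaining agents -/

namespace RAM

open Function Code

/-- Writes the place of agent number `reg 11` of a cycle of length `reg 7` to register `12`. -/
def cyclePlaceCode : Code :=
  ite (.sub (.reg 7) (.add (.reg 11) (.reg 11))) (set 13 (.reg 11))
    (set 13 (.sub (.reg 7) (.reg 11))) ⨾
  ite (.get 6 (.reg 7))
    (ite (.add (.sub (.num 6) (.reg 7)) (.sub (.reg 13) (.num 2))) (set 14 (.num 1))
      (set 14 (.num 0))) (set 14 (.num 0)) ⨾
  ite (.sub (.reg 7) (.add (.reg 11) (.reg 11)))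
    (set 12 (.sub (.add (.reg 13) (.reg 13)) (.reg 14)))
    (set 12 (.sub (.add (.reg 13) (.reg 13)) (.sub (.num 1) (.reg 14))))

theorem run_cyclePlaceCode {s : Mem} (h6 : s.arr 6 (s.reg 7) = s.reg 7 % 2) :
    (cyclePlaceCode.run s).reg 12 = cyclePlace (s.reg 7) (s.reg 11) := by
  have hswap : ∀ s' : Mem, s'.arr 6 (s'.reg 7) = s'.reg 7 % 2 →
      (ite (.get 6 (.reg 7))
        (ite (.add (.sub (.num 6) (.reg 7)) (.sub (.reg 13) (.num 2))) (set 14 (.num 1))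
          (set 14 (.num 0))) (set 14 (.num 0))).run s' =
        s'.setReg 14 (layoutSwap (s'.reg 7) (s'.reg 13)) := by
    intro s' h
    unfold layoutSwap
    rcases Nat.mod_two_eq_zero_or_one (s'.reg 7) with hp | hp
    · simp [run_ite, Term.eval, h, hp]
    · by_cases hc : s'.reg 7 ≤ 5 ∨ 3 ≤ s'.reg 13
      · have : 6 - s'.reg 7 + (s'.reg 13 - 2) ≠ 0 := by omega
        simp only [run_ite, run_set, Term.eval, h, hp, hc]
        simp only [if_true, and_self]
        rw [if_pos (by norm_num)]
        exact if_pos this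
      · have : 6 - s'.reg 7 + (s'.reg 13 - 2) = 0 := by omega
        simp only [run_ite, run_set, Term.eval, h, hp, this, hc]
        simp
  unfold cyclePlaceCode cyclePlace
  by_cases h1 : 2 * s.reg 11 < s.reg 7
  · have h2 : s.reg 7 - (s.reg 11 + s.reg 11) ≠ 0 := by omega
    have hfirst : (ite (.sub (.reg 7) (.add (.reg 11) (.reg 11))) (set 13 (.reg 11))
        (set 13 (.sub (.reg 7) (.reg 11)))).run s = s.setReg 13 (s.reg 11) := by
      simp [run_ite, Term.eval, h2]
    rw [run_seq, run_seq, hfirst, hswap _ (by simpa using h6), if_pos h1]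
    simp [run_ite, Term.eval, h2, two_mul]
  · have h2 : s.reg 7 - (s.reg 11 + s.reg 11) = 0 := by omega
    have hfirst : (ite (.sub (.reg 7) (.add (.reg 11) (.reg 11))) (set 13 (.reg 11))
        (set 13 (.sub (.reg 7) (.reg 11)))).run s = s.setReg 13 (s.reg 7 - s.reg 11) := by
      simp [run_ite, Term.eval, h2]
    rw [run_seq, run_seq, hfirst, hswap _ (by simpa using h6), if_neg h1]
    simp [run_ite, Term.eval, h2, two_mul]

/-- The tables that are used to place the agents. -/
structure Ready (f : ℕ → ℕ) (n : ℕ) (s : Mem) : Prop where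
  reg_zero : s.reg 0 = n
  friend : s.arr 4 = f
  period : ∀ i < n, s.arr 5 i = minimalPeriod f i
  parity : ∀ k ≤ n, s.arr 6 k = k % 2

variable {f : ℕ → ℕ} {n : ℕ} {s : Mem}

theorem Ready.setReg (R : Ready f n s) {x : ℕ} (hx : x ≠ 0) (v : ℕ) : Ready f n (s.setReg x v) :=
  ⟨by simp [R.1, hx.symm], R.2, R.3, R.4⟩

theorem Ready.run (R : Ready f n s) {c : Code}
    (hc : (c.keepsReg 0 && c.keepsArr 4 && c.keepsArr 5 && c.keepsArr 6) = true) :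
    Ready f n (c.run s) := by
  simp only [Bool.and_eq_true] at hc
  obtain ⟨⟨⟨h0, h4⟩, h5⟩, h6⟩ := hc
  refine ⟨?_, ?_, ?_, ?_⟩
  · rw [reg_run h0]; exact R.1
  · rw [arr_run h4]; exact R.2
  · rw [arr_run h5]; exact R.3
  · rw [arr_run h6]; exact R.4

/-- Places the agent in register `6` as number `reg 11` of her cycle, and goes on to her friend. -/
def blockStep : Code :=
  ite (.sub (.reg 7) (.reg 11))
    (cyclePlaceCode ⨾
      ite (.reg 8) (put 7 (.reg 6) (.add (.reg 10) (.reg 12)))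
        (put 7 (.reg 6) (.sub (.reg 9) (.add (.reg 12) (.num 1)))) ⨾
      set 6 (.get 4 (.reg 6))) skip

/-- Since loop bounds must be input sizes, the loop runs `n ≥ k` rounds, and the rounds from `k` on
do nothing. -/
theorem run_rep_blockStep (hf : ∀ i < n, f i < n) (R : Ready f n s) {z k : ℕ}
    (hz : z < n) (hk : minimalPeriod f z = k) (h7 : s.reg 7 = k) (h6 : s.reg 6 = z) :
    (∀ t < k, ((rep 11 (.reg 0) blockStep).run s).arr 7 (f^[t] z) =
      if s.reg 8 ≠ 0 then s.reg 10 + cyclePlace k t else s.reg 9 - (cyclePlace k t + 1)) ∧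
    ∀ j, (∀ t < k, j ≠ f^[t] z) → ((rep 11 (.reg 0) blockStep).run s).arr 7 j = s.arr 7 j := by
  have hkn : k ≤ n := hk ▸ minimalPeriod_le_of_maps hf hz
  have hN : (Term.reg 0).eval s = n := R.1
  obtain ⟨-, -, -, h⟩ := run_rep_induction (s := s) (x := 11) (e := .reg 0) (c := blockStep)
    (fun i s' => Ready f n s' ∧
      (s'.reg 7 = s.reg 7 ∧ s'.reg 8 = s.reg 8 ∧ s'.reg 9 = s.reg 9 ∧ s'.reg 10 = s.reg 10) ∧
      (i ≤ k → s'.reg 6 = f^[i] z) ∧ (∀ t < k, t < i → s'.arr 7 (f^[t] z) =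
        if s.reg 8 ≠ 0 then s.reg 10 + cyclePlace k t else s.reg 9 - (cyclePlace k t + 1)) ∧
      ∀ j, (∀ t < k, j ≠ f^[t] z) → s'.arr 7 j = s.arr 7 j)
    ⟨R.setReg (by norm_num) _, by simp, by simp [h6], by simp, by simp⟩ (by
      rintro i s' - hx ⟨R', ⟨k7, k8, k9, k10⟩, k6, kP, kP'⟩
      refine ⟨(R'.run (by decide)).setReg (by norm_num) _, ?_, ?_⟩
      · simp only [Mem.reg_setReg]
        norm_num
        rw [reg_run (by decide), reg_run (by decide), reg_run (by decide), reg_run (by decide)]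
        exact ⟨k7, k8, k9, k10⟩
      simp only [blockStep, run_ite, Term.eval, hx, k7, h7]
      by_cases hik : k ≤ i
      · rw [Nat.sub_eq_zero_of_le hik]
        refine ⟨fun h => absurd h (by omega), fun t ht _ => ?_, fun j hj => ?_⟩
        · exact kP t ht (by omega)
        · exact kP' j hj
      · rw [if_pos (by omega)]
        have h12 := run_cyclePlaceCode (s := s') (by rw [k7, h7]; exact R'.parity k hkn)
        rw [k7, h7, hx] at h12
        have e4 : (cyclePlaceCode.run s').arr 4 = f := by rw [arr_run (by decide)]; exact R'.2
        have e6 : (cyclePlaceCode.run s').reg 6 = f^[i] z := by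
          rw [reg_run (by decide), k6 (by omega)]
        have e8 : (cyclePlaceCode.run s').reg 8 = s.reg 8 := by rw [reg_run (by decide), k8]
        have e9 : (cyclePlaceCode.run s').reg 9 = s.reg 9 := by rw [reg_run (by decide), k9]
        have e10 : (cyclePlaceCode.run s').reg 10 = s.reg 10 := by rw [reg_run (by decide), k10]
        have e7 : (cyclePlaceCode.run s').arr 7 = s'.arr 7 := arr_run (by decide) _
        have hrun : (ite (.reg 8) (put 7 (.reg 6) (.add (.reg 10) (.reg 12)))
            (put 7 (.reg 6) (.sub (.reg 9) (.add (.reg 12) (.num 1))))).run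
              (cyclePlaceCode.run s') = (cyclePlaceCode.run s').setArr 7 (f^[i] z)
              (if s.reg 8 ≠ 0 then s.reg 10 + cyclePlace k i
                else s.reg 9 - (cyclePlace k i + 1)) := by
          simp only [run_ite, run_put, Term.eval, e6, e8, e9, e10, h12]
          split_ifs <;> rfl
        simp only [run_seq, hrun, run_set, Term.eval, Mem.reg_setArr, e6]
        refine ⟨fun _ => ?_, fun t ht hti => ?_, fun j hj => ?_⟩
        · simp [e4, ← iterate_succ_apply' f]
        · rcases eq_or_ne t i with rfl | hti'
          · simp
          · have hne : f^[t] z ≠ f^[i] z := fun h => hti'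
              ((iterate_eq_iterate_iff_of_lt_minimalPeriod (by omega) (by omega)).1 h)
            simpa [hne, e7] using kP t ht (by omega)
        · simpa [hj i (by omega), e7] using kP' j hj)
  rw [hN] at h
  exact ⟨fun t ht => h.1 t ht (by omega), h.2⟩

/-- Places the cycle of the agent in register `6`: to the right of the interval of occupied places,
or to the left of the middle if it is the first one. -/
def blockCode : Code :=
  ite (.get 7 (.reg 6)) skip
    (ite (.get 5 (.reg 6))
      (set 7 (.get 5 (.reg 6)) ⨾ set 8 (.sub (.reg 10) (.reg 9)) ⨾ rep 11 (.reg 0) blockStep ⨾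
        ite (.reg 8) (set 10 (.add (.reg 10) (.reg 7))) (set 9 (.sub (.reg 9) (.reg 7))))
      skip)

theorem run_blockCode (hf : ∀ i < n, f i < n) (R : Ready f n s) {z k : ℕ}
    (hz : z < n) (hk : minimalPeriod f z = k) (h6 : s.reg 6 = z) (hP : s.arr 7 z = 0)
    (hk0 : k ≠ 0) :
    ((blockCode.run s).reg 9 = if s.reg 9 < s.reg 10 then s.reg 9 else s.reg 9 - k) ∧
    ((blockCode.run s).reg 10 = if s.reg 9 < s.reg 10 then s.reg 10 + k else s.reg 10) ∧
    (∀ t < k, (blockCode.run s).arr 7 (f^[t] z) =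
      if s.reg 9 < s.reg 10 then s.reg 10 + cyclePlace k t else s.reg 9 - (cyclePlace k t + 1)) ∧
    ∀ j, (∀ t < k, j ≠ f^[t] z) → (blockCode.run s).arr 7 j = s.arr 7 j := by
  have h5 : s.arr 5 z = k := hk ▸ R.period z hz
  set s₁ := (s.setReg 7 k).setReg 8 (s.reg 10 - s.reg 9) with hs₁
  obtain ⟨h1, h2⟩ := run_rep_blockStep hf (s := s₁)
    ((R.setReg (by norm_num) _).setReg (by norm_num) _) hz hk (by simp [hs₁]) (by simp [hs₁, h6])
  have e8 : s₁.reg 8 = s.reg 10 - s.reg 9 := by simp [hs₁]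
  have e9 : s₁.reg 9 = s.reg 9 := by simp [hs₁]
  have e10 : s₁.reg 10 = s.reg 10 := by simp [hs₁]
  have e7 : s₁.reg 7 = k := by simp [hs₁]
  have hrun : blockCode.run s = (ite (.reg 8) (set 10 (.add (.reg 10) (.reg 7)))
      (set 9 (.sub (.reg 9) (.reg 7)))).run ((rep 11 (.reg 0) blockStep).run s₁) := by
    simp [blockCode, run_ite, Term.eval, h6, hP, h5, hk0, hs₁]
  have g7 : ((rep 11 (.reg 0) blockStep).run s₁).reg 7 = k := by rw [reg_run (by decide), e7]
  have g8 : ((rep 11 (.reg 0) blockStep).run s₁).reg 8 = s.reg 10 - s.reg 9 := by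
    rw [reg_run (by decide), e8]
  have g9 : ((rep 11 (.reg 0) blockStep).run s₁).reg 9 = s.reg 9 := by
    rw [reg_run (by decide), e9]
  have g10 : ((rep 11 (.reg 0) blockStep).run s₁).reg 10 = s.reg 10 := by
    rw [reg_run (by decide), e10]
  simp only [hrun, run_ite, Term.eval, run_set, g7, g8, g9, g10]
  rw [e8, e9, e10] at h1
  have hiff : s.reg 10 - s.reg 9 ≠ 0 ↔ s.reg 9 < s.reg 10 := by omega
  simp only [hiff] at h1 ⊢
  split_ifs at h1 ⊢
  · refine ⟨?_, by simp, h1, h2⟩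
    rw [Mem.reg_setReg, if_neg (by norm_num), g9]
  · refine ⟨by simp, ?_, h1, h2⟩
    rw [Mem.reg_setReg, if_neg (by norm_num), g10]

/-- The memory holds a layout of some of the agents. -/
def Holds (f : ℕ → ℕ) (n h : ℕ) (s : Mem) : Prop := Layout f n h (s.arr 7) (s.reg 9) (s.reg 10)

theorem holds_blockCode (hf : ∀ i < n, f i < n) (R : Ready f n s) {h z : ℕ} (H : Holds f n h s)
    (hlr : s.reg 9 < s.reg 10) (hz : z < n) (h6 : s.reg 6 = z) :
    Holds f n h (blockCode.run s) ∧ (blockCode.run s).reg 9 = s.reg 9 ∧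
      s.reg 10 ≤ (blockCode.run s).reg 10 ∧
      (∀ j, s.arr 7 j ≠ 0 → (blockCode.run s).arr 7 j ≠ 0) ∧
      (minimalPeriod f z ≠ 0 → (blockCode.run s).arr 7 z ≠ 0) := by
  by_cases hP : s.arr 7 z = 0
  · by_cases hk : minimalPeriod f z = 0
    · have : blockCode.run s = s := by
        simp [blockCode, run_ite, Term.eval, h6, R.period z hz, hk]
      rw [this]
      exact ⟨H, rfl, le_rfl, fun _ => id, fun h => absurd hk h⟩
    · obtain ⟨h9, h10, h1, h2⟩ := run_blockCode hf R hz rfl h6 hP hk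
      simp only [if_pos hlr] at h9 h10 h1
      have hmid := H.mid_le
      refine ⟨?_, h9, by omega, fun j hj => ?_, fun _ => ?_⟩
      · rw [Holds, h9, h10]
        exact H.add_cycle hlr hf hz rfl hP h1 h2
      · by_cases hj' : ∃ t < minimalPeriod f z, j = f^[t] z
        · obtain ⟨t, ht, rfl⟩ := hj'
          rw [h1 t ht]
          omega
        · push Not at hj'
          rwa [h2 j hj']
      · have := h1 0 (by omega)
        rw [iterate_zero, id] at this
        omega
  · have : blockCode.run s = s := by
      simp [blockCode, run_ite, Term.eval, h6, hP]
    rw [this]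
    exact ⟨H, rfl, le_rfl, fun _ => id, fun _ => hP⟩

/-- Places the agent in register `6` next to the interval of occupied places, on the side that is
closer to her friend, if her friend is placed. -/
def insertCode : Code :=
  ite (.get 7 (.reg 6)) skip
    (ite (.get 7 (.get 4 (.reg 6)))
      (set 7 (.get 7 (.get 4 (.reg 6))) ⨾
        ite (.sub (.add (.reg 10) (.reg 9)) (.add (.add (.reg 7) (.reg 7)) (.num 1)))
          (set 9 (.sub (.reg 9) (.num 1)) ⨾ put 7 (.reg 6) (.reg 9))
          (put 7 (.reg 6) (.reg 10) ⨾ set 10 (.add (.reg 10) (.num 1))))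
      skip)

/-- The last two conjuncts serve the insertion right after the first cycle: either it fills the
place to the right of the cycle, or it changes nothing on the left. -/
theorem holds_insertCode (hf : ∀ i < n, f i < n) (R : Ready f n s) {h z : ℕ} (H : Holds f n h s)
    (hz : z < n) (h6 : s.reg 6 = z) :
    Holds f n h (insertCode.run s) ∧
      (insertCode.run s).reg 9 ≤ s.reg 9 ∧ s.reg 10 ≤ (insertCode.run s).reg 10 ∧
      (∀ j, s.arr 7 j ≠ 0 → (insertCode.run s).arr 7 j ≠ 0) ∧
      (s.arr 7 (f z) ≠ 0 → (insertCode.run s).arr 7 z ≠ 0) ∧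
      (s.arr 7 z = 0 → s.arr 7 (f z) ≠ 0 → s.reg 10 + s.reg 9 ≤ 2 * s.arr 7 (f z) + 1 →
        (insertCode.run s).reg 10 = s.reg 10 + 1) ∧
      (s.arr 7 z ≠ 0 → (insertCode.run s).reg 9 = s.reg 9) := by
  by_cases hP : s.arr 7 z = 0
  · by_cases hq : s.arr 7 (f z) = 0
    · have : insertCode.run s = s := by
        simp [insertCode, run_ite, Term.eval, h6, R.friend, hq]
      rw [this]
      exact ⟨H, le_rfl, le_rfl, fun _ => id, fun h => absurd hq h, fun _ h => absurd hq h,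
        fun _ => rfl⟩
    · have hmid := H.mid_le
      have hlt := H.lt_add hz hP
      by_cases hside : s.reg 10 + s.reg 9 ≤ 2 * s.arr 7 (f z) + 1
      · have hrun : insertCode.run s =
            ((s.setReg 7 (s.arr 7 (f z))).setArr 7 z (s.reg 10)).setReg 10 (s.reg 10 + 1) := by
          have : s.reg 10 + s.reg 9 - (s.arr 7 (f z) + s.arr 7 (f z) + 1) = 0 := by omega
          simp [insertCode, run_ite, Term.eval, h6, R.friend, hq, hP, this]
        have harr : (insertCode.run s).arr 7 = update (s.arr 7) z (s.reg 10) := by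
          rw [hrun]; funext j; simp [update_apply]
        have h9 : (insertCode.run s).reg 9 = s.reg 9 := by rw [hrun]; simp
        have h10 : (insertCode.run s).reg 10 = s.reg 10 + 1 := by rw [hrun]; simp
        refine ⟨?_, h9.le, by omega, fun j hj => ?_, fun _ => ?_, fun _ _ _ => h10, fun _ => h9⟩
        · rw [Holds, harr, h9, h10]
          exact H.insert_right hz hP hq hf hside
        · rw [harr, update_apply]
          split_ifs <;> omega
        · rw [harr, update_self]
          omega
      · have hrun : insertCode.run s =
            (((s.setReg 7 (s.arr 7 (f z))).setReg 9 (s.reg 9 - 1)).setArr 7 z (s.reg 9 - 1)) := by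
          have : s.reg 10 + s.reg 9 - (s.arr 7 (f z) + s.arr 7 (f z) + 1) ≠ 0 := by omega
          simp [insertCode, run_ite, Term.eval, h6, R.friend, hq, hP, this]
        have harr : (insertCode.run s).arr 7 = update (s.arr 7) z (s.reg 9 - 1) := by
          rw [hrun]; funext j; simp [update_apply]
        have h9 : (insertCode.run s).reg 9 = s.reg 9 - 1 := by rw [hrun]; simp
        have h10 : (insertCode.run s).reg 10 = s.reg 10 := by rw [hrun]; simp
        refine ⟨?_, by omega, h10.ge, fun j hj => ?_, fun _ => ?_, fun _ _ h => absurd h hside,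
          fun h => absurd hP h⟩
        · rw [Holds, harr, h9, h10]
          exact H.insert_left hz hP hq hf (by omega)
        · rw [harr, update_apply]
          split_ifs <;> omega
        · rw [harr, update_self]
          omega
  · have : insertCode.run s = s := by
      simp [insertCode, run_ite, Term.eval, h6, hP]
    rw [this]
    exact ⟨H, le_rfl, le_rfl, fun _ => id, fun _ => hP, fun h => absurd h hP, fun _ => rfl⟩

/-- Places the cycles of all agents. -/
def blocksCode : Code := rep 2 (.reg 0) (set 6 (.reg 2) ⨾ blockCode)

theorem holds_blocksCode (hf : ∀ i < n, f i < n) (R : Ready f n s) {h : ℕ} (H : Holds f n h s)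
    (hlr : s.reg 9 < s.reg 10) :
    Holds f n h (blocksCode.run s) ∧ (blocksCode.run s).reg 9 = s.reg 9 ∧
      s.reg 10 ≤ (blocksCode.run s).reg 10 ∧
      ∀ j < n, minimalPeriod f j ≠ 0 → (blocksCode.run s).arr 7 j ≠ 0 := by
  have hN : (Term.reg 0).eval s = n := R.1
  rw [← hN]
  refine (run_rep_induction (s := s) (x := 2) (e := .reg 0) (fun i s' => Ready f n s' ∧
    Holds f (Term.eval s (.reg 0)) h s' ∧ s'.reg 9 = s.reg 9 ∧ s.reg 10 ≤ s'.reg 10 ∧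
    ∀ j < i, minimalPeriod f j ≠ 0 → s'.arr 7 j ≠ 0) ?_ ?_).2
  · rw [hN]
    exact ⟨R.setReg (by norm_num) _, by simpa [Holds] using H, by simp, by simp, by simp⟩
  · rintro i s' hi hx ⟨R', H', k9, k10, kP⟩
    rw [hN] at hi H' ⊢
    simp only [run_seq, run_set, Term.eval, hx]
    have R'' : Ready f n (s'.setReg 6 i) := R'.setReg (by norm_num) _
    obtain ⟨h1, h2, h3, h4, h5⟩ := holds_blockCode hf R'' (h := h) (z := i)
      (by simpa [Holds] using H') (by simp; omega) hi (by simp)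
    refine ⟨(R''.run (by decide)).setReg (by norm_num) _, by simpa [Holds] using h1, ?_, ?_, ?_⟩
    · simpa [k9] using h2
    · simp at h3 ⊢; omega
    · intro j hj hjk
      rcases eq_or_ne j i with rfl | hji
      · exact h5 hjk
      · exact h4 j (kP j (by omega) hjk)

/-- Places all agents whose friends are placed. -/
def insertsCode : Code := rep 2 (.reg 0) (set 6 (.reg 2) ⨾ insertCode)

theorem holds_insertsCode (hf : ∀ i < n, f i < n) (R : Ready f n s) {h : ℕ} (H : Holds f n h s) :
    Holds f n h (insertsCode.run s) ∧ s.reg 10 ≤ (insertsCode.run s).reg 10 ∧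
      (∀ j, s.arr 7 j ≠ 0 → (insertsCode.run s).arr 7 j ≠ 0) ∧
      ∀ j < n, s.arr 7 (f j) ≠ 0 → (insertsCode.run s).arr 7 j ≠ 0 := by
  have hN : (Term.reg 0).eval s = n := R.1
  rw [← hN]
  refine (run_rep_induction (s := s) (x := 2) (e := .reg 0) (fun i s' => Ready f n s' ∧
    Holds f (Term.eval s (.reg 0)) h s' ∧ s.reg 10 ≤ s'.reg 10 ∧
    (∀ j, s.arr 7 j ≠ 0 → s'.arr 7 j ≠ 0) ∧
    ∀ j < i, s.arr 7 (f j) ≠ 0 → s'.arr 7 j ≠ 0) ?_ ?_).2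
  · rw [hN]
    exact ⟨R.setReg (by norm_num) _, by simpa [Holds] using H, by simp, by simp, by simp⟩
  · rintro i s' hi hx ⟨R', H', k10, kP, kP'⟩
    rw [hN] at hi H' ⊢
    simp only [run_seq, run_set, Term.eval, hx]
    have R'' : Ready f n (s'.setReg 6 i) := R'.setReg (by norm_num) _
    obtain ⟨h1, -, h3, h4, h5, -, -⟩ := holds_insertCode hf R'' (h := h) (z := i)
      (by simpa [Holds] using H') hi (by simp)
    refine ⟨(R''.run (by decide)).setReg (by norm_num) _, by simpa [Holds] using h1, ?_, ?_, ?_⟩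
    · simp at h3 ⊢; omega
    · exact fun j hj => h4 j (kP j hj)
    · intro j hj hjk
      rcases eq_or_ne j i with rfl | hji
      · exact h5 (kP _ hjk)
      · exact h4 j (kP' j (by omega) hjk)

/-- After `r` passes every agent whose `r`-th iterate lies on a cycle is placed, and `n` passes
reach everybody. -/
theorem holds_rep_insertsCode (hf : ∀ i < n, f i < n) (R : Ready f n s) {h : ℕ}
    (H : Holds f n h s) (hcyc : ∀ j < n, minimalPeriod f j ≠ 0 → s.arr 7 j ≠ 0) :
    Holds f n h ((rep 3 (.reg 0) insertsCode).run s) ∧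
      s.reg 10 ≤ ((rep 3 (.reg 0) insertsCode).run s).reg 10 ∧
      ∀ j < n, ((rep 3 (.reg 0) insertsCode).run s).arr 7 j ≠ 0 := by
  have hN : (Term.reg 0).eval s = n := R.1
  have key := run_rep_induction (s := s) (x := 3) (e := .reg 0) (c := insertsCode)
    (fun r s' => Ready f n s' ∧ Holds f n h s' ∧ s.reg 10 ≤ s'.reg 10 ∧
      ∀ j < n, minimalPeriod f (f^[r] j) ≠ 0 → s'.arr 7 j ≠ 0)
    ⟨R.setReg (by norm_num) _, by simpa [Holds] using H, by simp, hcyc⟩ (by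
      rintro r s' - - ⟨R', H', k10, kP⟩
      obtain ⟨h1, h2, h3, h4⟩ := holds_insertsCode hf R' H'
      refine ⟨(R'.run (by decide)).setReg (by norm_num) _, by simpa [Holds] using h1, ?_, ?_⟩
      · simp; omega
      · exact fun j hj hjr => h4 j hj (kP (f j) (hf j hj) hjr))
  rw [hN] at key
  obtain ⟨-, h1, h2, h3⟩ := key
  refine ⟨h1, h2, fun j hj => h3 j hj ?_⟩
  have := minimalPeriod_pos_of_mem_periodicPts (iterate_mem_periodicPts hf hj)
  omega

/-- Places all agents, starting with the cycle of the agent in register `6` and the agent in cell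
`0` of array `10`. -/
def placeCode : Code :=
  set 9 (.add (.reg 0) (.num 1)) ⨾ set 10 (.add (.reg 0) (.num 1)) ⨾ blockCode ⨾
  set 6 (.get 10 (.num 0)) ⨾ insertCode ⨾ blocksCode ⨾ rep 3 (.reg 0) insertsCode

/-- The alternative `hxz` names what occupies the place to the right of the first cycle: the agent
`x`, or a second cycle. -/
theorem layout_placeCode (hf : ∀ i < n, f i < n) (R : Ready f n s) (h7 : s.arr 7 = 0)
    {x z : ℕ} (hx : s.arr 10 0 = x) (hxn : x < n) (h6 : s.reg 6 = z) (hz : z < n)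
    (hk0 : minimalPeriod f z ≠ 0)
    (hxz : (minimalPeriod f x = 0 ∧ z = f x) ∨ x = z ∧ ∀ i < n, minimalPeriod f i ≠ 0)
    (hbad : ∀ i < n, minimalPeriod f i = n → n ≠ 3 ∧ n ≠ 5) :
    Layout f n 0 ((placeCode.run s).arr 7) ((placeCode.run s).reg 9) ((placeCode.run s).reg 10) ∧
      ∀ i < n, (placeCode.run s).arr 7 i ≠ 0 := by
  set k := minimalPeriod f z with hk
  have hkn : k ≤ n := minimalPeriod_le_of_maps hf hz
  -- A debt: place `n + 1` is counted as occupied during the construction, and `hle` below shows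
  -- that it is in the end.
  set h := if k = 3 ∨ k = 5 then n + 2 else 0 with hh
  set s₁ := (s.setReg 9 (n + 1)).setReg 10 (n + 1) with hs₁
  have R₁ : Ready f n s₁ := (R.setReg (by norm_num) _).setReg (by norm_num) _
  obtain ⟨b9, b10, b1, b2⟩ := run_blockCode hf R₁ hz rfl (by simp [hs₁, h6]) (by simp [hs₁, h7]) hk0
  rw [← hk] at b9 b10 b1 b2
  simp only [hs₁, Mem.reg_setReg, Mem.arr_setReg, h7] at b9 b10 b1 b2
  norm_num at b9 b10 b1 b2
  rw [← hs₁] at b9 b10 b1 b2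
  set s₂ := blockCode.run s₁ with hs₂
  have R₂ : Ready f n s₂ := R₁.run (by decide)
  have H₂ : Holds f n h s₂ := by
    rw [Holds, b9, b10]
    refine Layout.of_cycle hf hz rfl (by omega) ?_ b2 ?_
    · intro t ht
      rw [b1 t ht]
      omega
    · intro h35
      rw [hh, if_pos h35]
  have hPz : s₂.arr 7 z = n := by
    have := b1 0 (by omega)
    rw [iterate_zero, id] at this
    rw [this]
    have : cyclePlace k 0 = 0 := by unfold cyclePlace layoutSwap; split_ifs <;> omega
    omega
  set s₃ := s₂.setReg 6 x with hs₃
  have R₃ : Ready f n s₃ := R₂.setReg (by norm_num) _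
  obtain ⟨c1, c9, c10, -, -, cx, cz⟩ := holds_insertCode hf R₃ (h := h) (z := x)
    (by simpa [Holds, hs₃] using H₂) hxn (by simp [hs₃])
  set s₄ := insertCode.run s₃ with hs₄
  have R₄ : Ready f n s₄ := R₃.run (by decide)
  simp only [hs₃, Mem.reg_setReg, Mem.arr_setReg] at c9 c10 cx cz
  norm_num at c9 c10 cx cz
  obtain ⟨d1, d9, d10, dP⟩ := holds_blocksCode hf R₄ c1 (by omega)
  set s₅ := blocksCode.run s₄ with hs₅
  have R₅ : Ready f n s₅ := R₄.run (by decide)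
  obtain ⟨e1, e10, eP⟩ := holds_rep_insertsCode hf R₅ d1 dP
  have hrun : placeCode.run s = (rep 3 (.reg 0) insertsCode).run s₅ := by
    have h10 : s₂.arr 10 0 = x := by
      rw [hs₂, arr_run (by decide)]; exact hx
    have hp : placeCode.run s = (rep 3 (.reg 0) insertsCode).run (blocksCode.run
        (insertCode.run (s₂.setReg 6 (s₂.arr 10 0)))) := by
      simp only [placeCode, run_seq, run_set, Term.eval, R.1]
      rw [Mem.reg_setReg, if_neg (by norm_num), R.1]
    rw [hp, h10]
  rw [hrun]
  refine ⟨?_, eP⟩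
  have hle : h ≤ ((rep 3 (.reg 0) insertsCode).run s₅).reg 10 := by
    by_cases h35 : k = 3 ∨ k = 5
    · rw [hh, if_pos h35]
      suffices n + 2 ≤ s₅.reg 10 by omega
      rcases hxz with ⟨hx0, hzx⟩ | ⟨hxz, hall⟩
      · have hPx : s₂.arr 7 x = 0 := by
          refine b2 x fun t ht hxt => ?_
          have h1 : 0 < minimalPeriod f (f^[t] z) := by
            rw [minimalPeriod_apply_iterate
              (minimalPeriod_pos_iff_mem_periodicPts.1 (by omega))]
            omega
          rw [← hxt] at h1
          omega
        rw [← hzx, hPz] at cx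
        have := cx hPx (by omega) (by omega)
        omega
      -- With everybody on cycles the interval has length `n > k` after the block phase, while its
      -- left end is still `n + 1 - k`; so it extends beyond `n + 1`.
      · have h1 := d1.eq_add fun j hj => dP j hj (hall j hj)
        have h2 : k ≠ n := by
          intro hkn'
          have := hbad z hz (hk ▸ hkn')
          omega
        rw [hxz, hPz] at cz
        have := cz (by omega)
        omega
    · rw [hh, if_neg h35]
      omega
  refine ⟨e1.pos, e1.le_mid, e1.mid_le, e1.bounds, e1.occupied, e1.inj, e1.closed, e1.left, ?_⟩
  intro i hi hP
  have := e1.right i hi hP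
  omega

end RAM

/-! ### The starting cycle, the output and the whole program -/

namespace RAM

open Function Code

variable {f : ℕ → ℕ} {n : ℕ} {s : Mem}

/-- Finds an agent outside the friendship cycles whose friend is on a cycle, if there is one, writes
her to cell `0` of array `10`, and chooses the cycle that is placed first. -/
def findCode : Code :=
  rep 2 (.reg 0) (ite (.get 5 (.reg 2)) skip
    (ite (.get 5 (.get 4 (.reg 2))) (put 10 (.num 0) (.reg 2)) skip)) ⨾
  ite (.get 5 (.get 10 (.num 0))) (set 6 (.get 10 (.num 0))) (set 6 (.get 4 (.get 10 (.num 0))))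

theorem run_findCode (hf : ∀ i < n, f i < n) (R : Ready f n s) (hn : 0 < n) (h10 : s.arr 10 0 = 0) :
    ∃ x z, (findCode.run s).arr 10 0 = x ∧ x < n ∧ (findCode.run s).reg 6 = z ∧ z < n ∧
      minimalPeriod f z ≠ 0 ∧
      ((minimalPeriod f x = 0 ∧ z = f x) ∨ x = z ∧ ∀ i < n, minimalPeriod f i ≠ 0) := by
  have hN : (Term.reg 0).eval s = n := R.1
  obtain ⟨x, hx, hx1, hx2⟩ := run_search (x := 2) (e := .reg 0)
    (c := ite (.get 5 (.reg 2)) skip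
      (ite (.get 5 (.get 4 (.reg 2))) (put 10 (.num 0) (.reg 2)) skip)) (s := s) (b := 10) (k := 0)
    (fun v => minimalPeriod f v = 0 ∧ minimalPeriod f (f v) ≠ 0) (by
      intro v hv u
      rw [hN] at hv
      by_cases h1 : minimalPeriod f v = 0 <;> by_cases h2 : minimalPeriod f (f v) = 0 <;>
        simp [run_ite, Term.eval, R.friend, R.period v hv, R.period _ (hf v hv), h1, h2])
  rw [hN] at hx hx1 hx2
  have hxn : x < n := by
    by_cases h : ∃ v < n, minimalPeriod f v = 0 ∧ minimalPeriod f (f v) ≠ 0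
    · exact (hx1 h).2
    · rw [hx2 (by simpa using h), h10]
      exact hn
  have hrun : findCode.run s =
      ((s.setReg 2 n).setArr 10 0 x).setReg 6 (if minimalPeriod f x = 0 then f x else x) := by
    rw [findCode, run_seq, hx]
    by_cases h1 : minimalPeriod f x = 0 <;>
      simp [run_ite, Term.eval, R.friend, R.period x hxn, h1]
  rw [hrun]
  refine ⟨x, _, by simp, hxn, by simp; rfl, ?_⟩
  by_cases h : ∃ v < n, minimalPeriod f v = 0 ∧ minimalPeriod f (f v) ≠ 0
  · obtain ⟨⟨h1, h2⟩, -⟩ := hx1 h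
    rw [if_pos h1]
    exact ⟨hf x hxn, h2, .inl ⟨h1, rfl⟩⟩
  · have hall : ∀ i < n, minimalPeriod f i ≠ 0 := by
      intro i hi h0
      have hiter : ∀ t, minimalPeriod f (f^[t] i) = 0 := by
        intro t
        induction t with
        | zero => exact h0
        | succ t ih =>
          rw [iterate_succ_apply']
          by_contra h'
          exact h ⟨_, iterate_lt hf hi t, ih, h'⟩
      have h1 := minimalPeriod_pos_of_mem_periodicPts (iterate_mem_periodicPts hf hi)
      have h2 := hiter n
      omega
    rw [if_neg (hall x hxn)]
    exact ⟨hxn, hall x hxn, .inr ⟨rfl, hall⟩⟩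

/-- Writes the assignment to array `2`. -/
def outputCode : Code := rep 2 (.reg 0) (put 2 (.reg 2) (.get 3 (.get 7 (.reg 2))))

theorem run_outputCode : ∀ i < s.reg 0, (outputCode.run s).arr 2 i = s.arr 3 (s.arr 7 i) := by
  change ∀ i < (Term.reg 0).eval s, _
  refine (run_rep_induction (s := s) (x := 2) (e := .reg 0) (fun i s' => s'.arr 3 = s.arr 3 ∧
    s'.arr 7 = s.arr 7 ∧ ∀ j < i, s'.arr 2 j = s.arr 3 (s.arr 7 j)) ?_ ?_).2.2
  · simp
  · rintro i s' - hx ⟨k3, k7, k2⟩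
    refine ⟨?_, ?_, fun j hj => ?_⟩
    · funext j; simp [k3]
    · funext j; simp [k7]
    · rcases eq_or_ne j i with rfl | hji
      · simp [Term.eval, hx, k3, k7]
      · simp [Term.eval, hx, hji, k2 j (by omega)]

/-- Computes the tables that describe the input. -/
def tablesCode : Code :=
  multiplesCode 8 1 ⨾ multiplesCode 9 0 ⨾ parityCode ⨾ walkCode ⨾ friendCode ⨾ periodCode

/-- Computes a stable assignment. -/
def stableCode : Code := tablesCode ⨾ findCode ⨾ placeCode ⨾ outputCode

theorem wellFormed_stableCode : stableCode.wellFormed = true := by decide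

end RAM

/-! ### From layouts back to games -/

open Function

/-- The function `f` maps the number of an agent to the number of her friend, and to itself if she
has no friend. -/
structure IsFriendMap {N : Type*} (F : Digraph N) {n : ℕ} (e : N ≃ Fin n) (f : ℕ → ℕ) : Prop where
  lt : ∀ i < n, f i < n
  of_adj : ∀ i j, F.Adj i j → f (e i) = e j
  of_not_adj : ∀ i, (∀ j, ¬ F.Adj i j) → f (e i) = e i

namespace IsFriendMap

variable {N : Type*} {F : Digraph N} {n : ℕ} {e : N ≃ Fin n} {f : ℕ → ℕ}

/-- An orbit of full length enumerates all agents. The bound `2 ≤ n` excludes a single friendless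
agent, who is a fixed point of `f` without being a loop of `F`. -/
theorem isDirectedCycle (h : IsFriendMap F e f) (hn : 2 ≤ n) {i : ℕ} (hi : i < n)
    (hper : minimalPeriod f i = n) : IsDirectedCycle F n := by
  have : NeZero n := ⟨by omega⟩
  have : Fact (1 < n) := ⟨by omega⟩
  let φ : ZMod n → N := fun x => e.symm ⟨f^[x.val] i, iterate_lt h.lt hi _⟩
  have heφ : ∀ x, (e (φ x) : ℕ) = f^[x.val] i := fun x => by simp [φ]
  have hinj : Injective φ := by
    intro x y hxy
    have h1 : f^[x.val] i = f^[y.val] i := by rw [← heφ, ← heφ, hxy]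
    exact ZMod.val_injective n ((iterate_eq_iterate_iff_of_lt_minimalPeriod
      (by rw [hper]; exact x.val_lt) (by rw [hper]; exact y.val_lt)).1 h1)
  have hbij : Bijective (fun x => e (φ x)) :=
    (Fintype.bijective_iff_injective_and_card _).2
      ⟨e.injective.comp hinj, by simp [ZMod.card]⟩
  have hφ : Bijective φ := (Equiv.comp_bijective φ e).1 hbij
  have hsucc : ∀ x, f (e (φ x)) = e (φ (x + 1)) := by
    intro x
    rw [heφ, heφ, ZMod.val_add, ZMod.val_one, ← iterate_succ_apply' f]
    have hmod := iterate_mod_minimalPeriod_eq (f := f) (x := i) (n := x.val + 1)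
    rw [hper] at hmod
    exact hmod.symm
  have hone : ∀ x : ZMod n, x + 1 ≠ x := by
    intro x hx
    simp at hx
  refine ⟨Equiv.ofBijective φ hφ, fun x y => ?_⟩
  simp only [Equiv.ofBijective_apply]
  constructor
  · intro hadj
    have h1 := h.of_adj _ _ hadj
    rw [hsucc, Fin.val_inj, e.apply_eq_iff_eq] at h1
    exact (hinj h1).symm
  · rintro rfl
    by_contra hnot
    have h1 : ∀ j, ¬ F.Adj (φ x) j := by
      intro j hj
      have h2 := h.of_adj _ _ hj
      rw [hsucc, Fin.val_inj, e.apply_eq_iff_eq] at h2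
      exact hnot (h2 ▸ hj)
    have h2 := h.of_not_adj _ h1
    rw [hsucc, Fin.val_inj, e.apply_eq_iff_eq] at h2
    exact hone x (hinj h2)

theorem ne_of_minimalPeriod (h : IsFriendMap F e f) (h3 : ¬ IsDirectedCycle F 3)
    (h5 : ¬ IsDirectedCycle F 5) : ∀ i < n, minimalPeriod f i = n → n ≠ 3 ∧ n ≠ 5 := by
  intro i hi hper
  constructor
  · rintro rfl
    exact h3 (h.isDirectedCycle (by norm_num) hi hper)
  · rintro rfl
    exact h5 (h.isDirectedCycle (by norm_num) hi hper)

end IsFriendMap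

theorem exists_isFriendMap {N V : Type*} {T : TDG N V} (hT : T.AtMostOneFriend) {n : ℕ}
    (e : N ≃ Fin n) : ∃ f, IsFriendMap T.friendshipGraph e f := by
  classical
  let g : N → N := fun i => if h : ∃ j, T.friendshipGraph.Adj i j then h.choose else i
  refine ⟨fun k => if h : k < n then e (g (e.symm ⟨k, h⟩)) else 0, ?_, ?_, ?_⟩
  · intro i hi
    simp [hi]
  · intro i j hij
    have h : ∃ j, T.friendshipGraph.Adj i j := ⟨j, hij⟩
    simp [g, h, hT.1 i _ _ h.choose_spec hij]
  · intro i hi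
    simp [g, hi]

/-- Runs the placing phase on a memory whose tables are filled in by hand, so that no topology or
adjacency matrix is needed. -/
theorem exists_layout {f : ℕ → ℕ} {n : ℕ} (hf : ∀ i < n, f i < n)
    (hbad : ∀ i < n, minimalPeriod f i = n → n ≠ 3 ∧ n ≠ 5) :
    ∃ P l r, Layout f n 0 P l r ∧ ∀ i < n, P i ≠ 0 := by
  rcases Nat.eq_zero_or_pos n with rfl | hn
  · exact ⟨0, 1, 1, ⟨by simp, by simp, by simp, by simp, by omega, by simp, by simp, by simp,
      by simp⟩, by simp⟩
  · let s : RAM.Mem :=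
      ⟨fun y => if y = 0 then n else 0, fun b k => if b = 4 then f k else
        if b = 5 then minimalPeriod f k else if b = 6 then k % 2 else 0⟩
    have R : RAM.Ready f n s := ⟨rfl, rfl, fun _ _ => rfl, fun _ _ => rfl⟩
    obtain ⟨x, z, h10, hx, h6, hz, hk0, hxz⟩ := RAM.run_findCode hf R hn rfl
    have h7 : (RAM.findCode.run s).arr 7 = 0 := by
      rw [RAM.Code.arr_run (by decide)]
      rfl
    have := RAM.layout_placeCode hf (R.run (c := RAM.findCode) (by decide)) h7 h10 hx h6 hz hk0
      hxz hbad
    exact ⟨_, _, _, this⟩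

/-- The interval has at most `n < m` places, so it winds injectively around the cycle. Each agent is
inside it, hence never farther from her friend than the empty nodes beyond the end on her own side;
`left` and `right` handle the opposite side. -/
theorem TDG.exists_isJumpStable_of_layout {N V : Type*} [Fintype N] [DecidableEq N] {T : TDG N V}
    (hT : T.AtMostOneFriend) {m n : ℕ} (hnm : n < m) {c : ℤ → V}
    (hc : IsCyclicWalk T.topology m c) {e : N ≃ Fin n} {f : ℕ → ℕ}
    (hF : IsFriendMap T.friendshipGraph e f) {P : ℕ → ℕ} {l r : ℕ} (L : Layout f n 0 P l r)
    (hall : ∀ i < n, P i ≠ 0) :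
    ∃ a : N ↪ V, (∀ i, a i = c (P (e i))) ∧ T.IsJumpStable a := by
  have hb : ∀ i : N, l ≤ P (e i) ∧ P (e i) < r := fun i =>
    L.bounds _ (e i).2 (hall _ (e i).2)
  have hlr := L.le_add
  have hinj : Injective fun i : N => c (P (e i)) := by
    intro i j hij
    have h1 := Int.eq_zero_of_abs_lt_dvd ((hc.eq_iff _ _).1 hij) (by
      have := hb i
      have := hb j
      rw [Int.abs_eq_natAbs]
      omega)
    exact e.injective (Fin.ext (L.inj _ (e i).2 _ (e j).2 (hall _ (e i).2) (by omega)))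
  refine ⟨⟨_, hinj⟩, fun i => rfl, TDG.isJumpStable_of_consecutive hT hc
    (P := fun i => (P (e i) : ℤ)) (l := l) (h := r) (fun i => rfl) ?_ ?_ ?_⟩
  · intro q h1 h2
    obtain ⟨i, hi, hq⟩ := L.occupied q.toNat (by omega) (by omega)
    exact ⟨e.symm ⟨i, hi⟩, by simp [hq]; omega⟩
  · intro i j hij
    have h1 := L.left _ (e i).2 (hall _ (e i).2)
    rw [hF.of_adj i j hij] at h1
    have := hb i
    have := hb j
    rw [Int.abs_eq_natAbs]
    omega
  · intro i j hij
    have h1 := L.right _ (e i).2 (hall _ (e i).2)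
    rw [hF.of_adj i j hij] at h1
    have := hb i
    have := hb j
    rw [Int.abs_eq_natAbs]
    omega

theorem TDG.exists_isJumpStable_iff {N V : Type*} [Fintype N] [DecidableEq N] [Fintype V]
    {T : TDG N V} (hG : IsCycleTopology T.topology) (hNV : Fintype.card N < Fintype.card V)
    (hT : T.AtMostOneFriend) :
    (∃ a : N ↪ V, T.IsJumpStable a) ↔
      ¬ IsDirectedCycle T.friendshipGraph 3 ∧ ¬ IsDirectedCycle T.friendshipGraph 5 := by
  obtain ⟨-, c, hc⟩ := IsCyclicWalk.exists_of_isCycleTopology hG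
  constructor
  · rintro ⟨a, ha⟩
    have hempty : ∃ v, v ∉ Set.range a := by
      by_contra! h
      have := Fintype.card_le_of_surjective a h
      omega
    exact ⟨TDG.not_isDirectedCycle_three hT hc hNV hempty ha,
      TDG.not_isDirectedCycle_five hT hc hNV hempty ha⟩
  · rintro ⟨h3, h5⟩
    obtain ⟨f, hF⟩ := exists_isFriendMap hT (Fintype.equivFin N)
    obtain ⟨P, l, r, L, hall⟩ := exists_layout hF.lt (hF.ne_of_minimalPeriod h3 h5)
    obtain ⟨a, -, ha⟩ := TDG.exists_isJumpStable_of_layout hT hNV hc hF L hall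
    exact ⟨a, ha⟩

/-! ### Correctness of the whole program -/

namespace RAM

open Code

theorem run_tablesCode {n m : ℕ} {T : TDG (Fin n) (Fin m)} (hG : IsCycleTopology T.topology)
    (hT : T.AtMostOneFriend) :
    ∃ f c, IsFriendMap T.friendshipGraph (Equiv.refl (Fin n)) f ∧ IsCyclicWalk T.topology m c ∧
      Ready f n (tablesCode.run (input T.topology T.friendshipGraph)) ∧
      ∀ j < 2 * m + 2,
        (tablesCode.run (input T.topology T.friendshipGraph)).arr 3 j = c (j : ℕ) := by
  obtain ⟨hm, c₀, hc₀⟩ := IsCyclicWalk.exists_of_isCycleTopology hG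
  rw [Fintype.card_fin] at hm hc₀
  set s₀ := input T.topology T.friendshipGraph with hs₀
  have a0 : s₀.arr 0 = adjacencyCells T.topology.Adj := by simp [hs₀, input]
  have a1 : s₀.arr 1 = adjacencyCells T.friendshipGraph.Adj := by simp [hs₀, input]
  have a2 : ∀ b, 2 ≤ b → s₀.arr b = 0 := by
    intro b hb
    simp [hs₀, input, show b ≠ 0 by omega, show b ≠ 1 by omega]
  have r0 : s₀.reg 0 = n := rfl
  have r1 : s₀.reg 1 = m := rfl
  set s₁ := (multiplesCode 8 1).run s₀ with hs₁
  set s₂ := (multiplesCode 9 0).run s₁ with hs₂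
  set s₃ := parityCode.run s₂ with hs₃
  set s₄ := walkCode.run s₃ with hs₄
  set s₅ := friendCode.run s₄ with hs₅
  have hrun : tablesCode.run s₀ = periodCode.run s₅ := rfl
  have h8 : ∀ k ≤ m, s₃.arr 8 k = k * m := by
    rw [hs₃, arr_run (by decide), hs₂, arr_run (by decide)]
    exact run_multiplesCode (b := 8) (x := 1) (by norm_num) (a2 8 (by norm_num))
  have h9 : ∀ k ≤ n, s₄.arr 9 k = k * n := by
    have h := run_multiplesCode (b := 9) (x := 0) (s := s₁) (by norm_num)
      (by rw [hs₁, arr_run (by decide)]; exact a2 9 (by norm_num))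
    rw [hs₁, reg_run (by decide), r0] at h
    rw [hs₄, arr_run (by decide), hs₃, arr_run (by decide)]
    exact h
  have h6 : ∀ k ≤ n, s₅.arr 6 k = k % 2 := by
    have h := run_parityCode (s := s₂)
      (by rw [hs₂, arr_run (by decide), hs₁, arr_run (by decide)]; exact a2 6 (by norm_num))
    rw [hs₂, reg_run (by decide), hs₁, reg_run (by decide), r0] at h
    rw [hs₅, arr_run (by decide), hs₄, arr_run (by decide)]
    exact h
  obtain ⟨c, hc, h3⟩ := run_walkCode (s := s₃) hm hc₀
    (by rw [hs₃, reg_run (by decide), hs₂, reg_run (by decide), hs₁, reg_run (by decide), r1])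
    (by rw [hs₃, arr_run (by decide), hs₂, arr_run (by decide), hs₁, arr_run (by decide), a0]) h8
    (by
      rw [hs₃, arr_run (by decide), hs₂, arr_run (by decide), hs₁, arr_run (by decide)]
      exact a2 3 (by norm_num))
  have h0 : s₄.reg 0 = n := by
    rw [hs₄, reg_run (by decide), hs₃, reg_run (by decide), hs₂, reg_run (by decide), hs₁,
      reg_run (by decide), r0]
  have h4 := run_friendCode (s := s₄) h0 h9
  have h1 : s₄.arr 1 = adjacencyCells T.friendshipGraph.Adj := by
    rw [hs₄, arr_run (by decide), hs₃, arr_run (by decide), hs₂, arr_run (by decide), hs₁,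
      arr_run (by decide), a1]
  rw [h1, ← hs₅] at h4
  have hf : ∀ i < n, s₅.arr 4 i < n := fun i hi => (h4 i hi).1
  have h5 := run_periodCode (s := s₅) hf (by rw [hs₅, reg_run (by decide), h0]) rfl (by
    rw [hs₅, arr_run (by decide), hs₄, arr_run (by decide), hs₃, arr_run (by decide), hs₂,
      arr_run (by decide), hs₁, arr_run (by decide)]
    exact a2 5 (by norm_num))
  refine ⟨s₅.arr 4, c, ⟨hf, ?_, ?_⟩, hc, ⟨?_, ?_, h5, ?_⟩, ?_⟩
  · intro i j hij
    have h := (h4 i i.2).2.1 ⟨j, j.2, adjacencyCells_ne_zero.2 hij⟩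
    have h' := adjacencyCells_ne_zero (v := i) (w := ⟨s₅.arr 4 i, hf i i.2⟩).1 h
    exact congrArg Fin.val (hT.1 i _ _ h' hij)
  · intro i hi
    refine (h4 i i.2).2.2 fun j hj => ?_
    by_contra h
    exact hi ⟨j, hj⟩ (adjacencyCells_ne_zero (v := i) (w := ⟨j, hj⟩).1 h)
  · rw [hrun, reg_run (by decide), hs₅, reg_run (by decide), h0]
  · rw [hrun, arr_run (by decide)]
  · rw [hrun, arr_run (by decide)]
    exact h6
  · rw [hrun, arr_run (by decide), hs₅, arr_run (by decide)]
    exact h3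

theorem outputs_stableCode {n m : ℕ} (hn : 0 < n) {T : TDG (Fin n) (Fin m)}
    (hG : IsCycleTopology T.topology) (hnm : n < m) (hT : T.AtMostOneFriend)
    (h3 : ¬ IsDirectedCycle T.friendshipGraph 3) (h5 : ¬ IsDirectedCycle T.friendshipGraph 5) :
    ∃ a : Fin n ↪ Fin m,
      Outputs (stableCode.run (input T.topology T.friendshipGraph)) a ∧ T.IsJumpStable a := by
  obtain ⟨f, c, hF, hc, R, hwalk⟩ := run_tablesCode hG hT
  set s₀ := input T.topology T.friendshipGraph with hs₀
  set s₁ := tablesCode.run s₀ with hs₁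
  have a2 : ∀ b, 2 ≤ b → s₀.arr b = 0 := by
    intro b hb
    simp [hs₀, input, show b ≠ 0 by omega, show b ≠ 1 by omega]
  obtain ⟨x, z, h10, hx, h6, hz, hk0, hxz⟩ := run_findCode hF.lt R hn (by
    rw [hs₁, arr_run (by decide), a2 10 (by norm_num)]
    rfl)
  set s₂ := findCode.run s₁ with hs₂
  have R₂ : Ready f n s₂ := R.run (by decide)
  obtain ⟨L, hall⟩ := layout_placeCode hF.lt R₂ (by
    rw [hs₂, arr_run (by decide), hs₁, arr_run (by decide), a2 7 (by norm_num)])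
    h10 hx h6 hz hk0 hxz (hF.ne_of_minimalPeriod h3 h5)
  set s₃ := placeCode.run s₂ with hs₃
  have R₃ : Ready f n s₃ := R₂.run (by decide)
  obtain ⟨a, ha, hst⟩ := TDG.exists_isJumpStable_of_layout hT hnm hc hF L hall
  refine ⟨a, fun i => ?_, hst⟩
  have hrun : stableCode.run s₀ = outputCode.run s₃ := by
    rw [stableCode, run_seq, run_seq, run_seq]
  have e3 : s₃.arr 3 = s₁.arr 3 := by
    rw [hs₃, arr_run (by decide), hs₂, arr_run (by decide)]
  have hb := L.bounds i i.2 (hall i i.2)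
  have hlr := L.le_add
  have hmid := L.le_mid
  -- Places are below `l + n ≤ 2 * n + 1`, which is why the walk was tabulated twice around the
  -- cycle.
  rw [hrun, run_outputCode i (by rw [R₃.1]; exact i.2), e3, hwalk _ (by omega), ha i,
    Equiv.refl_apply]

end RAM

/-- For topological distance games on a cycle in which each agent has at most one friend and utility
`0` for the others, a jump stable assignment exists iff the friendship graph is neither a 3-cycle
nor a 5-cycle; and one fixed program computes a jump stable assignment from the topology graph and
the friendship graph in polynomial time, for every such game that has one. -/
theorem theorem4p3 :
    (∀ (N : Type*) (V : Type*) [Fintype N] [DecidableEq N] [Fintype V] (T : TDG N V),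
      IsCycleTopology T.topology → Fintype.card N < Fintype.card V → T.AtMostOneFriend →
        ((∃ a : N ↪ V, T.IsJumpStable a) ↔
          ¬ IsDirectedCycle T.friendshipGraph 3 ∧ ¬ IsDirectedCycle T.friendshipGraph 5)) ∧
    (∃ (P : RAM.Prog) (p : Polynomial ℕ), ∀ (n m : ℕ) (T : TDG (Fin n) (Fin m)),
      IsCycleTopology T.topology → n < m → T.AtMostOneFriend →
        (∃ a : Fin n ↪ Fin m, T.IsJumpStable a) →
          ∃ (t : ℕ) (s : RAM.Mem) (a : Fin n ↪ Fin m),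
            RAM.Exec P (RAM.input T.topology T.friendshipGraph) t s ∧ t ≤ p.eval (n + m) ∧
              RAM.Outputs s a ∧ T.IsJumpStable a) := by
  refine ⟨fun N V _ _ _ T hG hNV hT => TDG.exists_isJumpStable_iff hG hNV hT,
    RAM.stableCode.compile, RAM.stableCode.time, fun n m T hG hnm hT hex => ?_⟩
  obtain ⟨t, ht, hexec⟩ := RAM.Code.exec_compile RAM.wellFormed_stableCode
    (RAM.input T.topology T.friendshipGraph)
  -- Without agents, cell `0` of array `10` names no agent and the invariants do not apply, but any
  -- memory is a correct output.
  rcases Nat.eq_zero_or_pos n with rfl | hn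
  · obtain ⟨a, ha⟩ := hex
    exact ⟨t, _, a, hexec, ht, fun i => i.elim0, ha⟩
  · obtain ⟨h3, h5⟩ := (TDG.exists_isJumpStable_iff hG (by simpa using hnm) hT).1 hex
    obtain ⟨a, hout, hst⟩ := RAM.outputs_stableCode hn hG hnm hT h3 h5
    exact ⟨t, _, a, hexec, ht, hout, hst⟩
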